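/- For every integer $n\ge 0$ and every $\varepsilon>0$ there is a constant $C=C(n,\varepsilon)$ with the following property. Let $M$ be a finite simplicial complex of dimension at most $n$, let $\mathrm{Vol}(M)$ be the number of its $n$-simplices, and let $\alpha_1,\dots,\alpha_k\in H^1(M;\mathbb{Z}/2)$ be classes whose cup product $\alpha_1\smile\dots\smile\alpha_k\in H^k(M;\mathbb{Z}/2)$ is non-zero. Then $$\mathrm{sys}^{\alpha_1}(M)\cdots \mathrm{sys}^{\alpha_k}(M)\cdot \mathrm{cut}^{\alpha_1\smile\dots\smile\alpha_k}(M)\;\le\; C\,\mathrm{Vol}(M)^{1+\varepsilon}.$$ Here, for a non-zero class $\alpha\in H^j(M;\mathbb{Z}/2)$, $\mathrm{sys}^{\alpha}(M)$ is the minimal number of $j$-simplices in a simplicial mod $2$ $j$-cycle of $M$ on which $\alpha$ evaluates non-trivially, and $\mathrm{cut}^{\alpha}(M)$ is the minimal number of $(n-j)$-simplices in a subcomplex $H\subseteq M$ of dimension at most $n-j$ such that $\alpha$ vanishes when restricted to $M\setminus H$ (the difference of the geometric realizations). -/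

import Mathlib

open scoped NNReal ENNReal

noncomputable section

/-! ## Singular cohomology with coefficients in `ZMod 2` -/

namespace SingularMod2

/-- Singular `k`-simplices of a space `X`. -/
abbrev Simplex (k : ℕ) (X : Type*) [TopologicalSpace X] : Type _ :=
  C(stdSimplex ℝ (Fin (k + 1)), X)

section

variable {X Y : Type*} [TopologicalSpace X] [TopologicalSpace Y]

/-- Precompose a singular simplex with the affine map of standard simplices that is given on
vertices by `φ`. -/
def Simplex.pull {p q : ℕ} (σ : Simplex q X) (φ : Fin (p + 1) → Fin (q + 1)) : Simplex p X :=
  σ.comp ⟨stdSimplex.map φ, stdSimplex.continuous_map φ⟩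

theorem Simplex.pull_pull {p q r : ℕ} (σ : Simplex r X) (φ : Fin (q + 1) → Fin (r + 1))
    (ψ : Fin (p + 1) → Fin (q + 1)) : (σ.pull φ).pull ψ = σ.pull (φ ∘ ψ) := by
  ext x
  exact congrArg σ (stdSimplex.map_comp_apply ψ φ x)

/-- Singular `k`-cochains. -/
abbrev Cochain (k : ℕ) (X : Type*) [TopologicalSpace X] : Type _ := Simplex k X → ZMod 2

/-- The coboundary operator; there are no signs modulo 2. -/
def coboundary (k : ℕ) (X : Type*) [TopologicalSpace X] :
    Cochain k X →ₗ[ZMod 2] Cochain (k + 1) X where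
  toFun f σ := ∑ i : Fin (k + 2), f (σ.pull i.succAbove)
  map_add' f g := by
    funext σ
    simp [Finset.sum_add_distrib]
  map_smul' a f := by
    funext σ
    simp [Finset.mul_sum]

/-- Singular `k`-cocycles. -/
def cocycles (k : ℕ) (X : Type*) [TopologicalSpace X] : Submodule (ZMod 2) (Cochain k X) :=
  LinearMap.ker (coboundary k X)

/-- Singular `k`-coboundaries. -/
def coboundaries : (k : ℕ) → (X : Type*) → [TopologicalSpace X] → Submodule (ZMod 2) (Cochain k X)
  | 0, _, _ => ⊥
  | k + 1, X, _ => LinearMap.range (coboundary k X)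

/-- The singular cohomology group `H^k(X; ZMod 2)`. -/
abbrev Cohomology (k : ℕ) (X : Type*) [TopologicalSpace X] : Type _ :=
  cocycles k X ⧸ (coboundaries k X).submoduleOf (cocycles k X)

/-- The cohomology class of a cocycle. -/
abbrev classOf {k : ℕ} (f : cocycles k X) : Cohomology k X := Submodule.Quotient.mk f

/-! ### Functoriality -/

/-- Pull-back of cochains along a continuous map. -/
def Cochain.pullback (k : ℕ) (u : C(X, Y)) : Cochain k Y →ₗ[ZMod 2] Cochain k X where
  toFun f σ := f (u.comp σ)
  map_add' _ _ := rfl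
  map_smul' _ _ := rfl

theorem Cochain.coboundary_pullback (k : ℕ) (u : C(X, Y)) (f : Cochain k Y) :
    coboundary k X (Cochain.pullback k u f) = Cochain.pullback (k + 1) u (coboundary k Y f) :=
  rfl

theorem Cochain.pullback_mem_cocycles {k : ℕ} (u : C(X, Y)) (f : Cochain k Y)
    (hf : f ∈ cocycles k Y) : Cochain.pullback k u f ∈ cocycles k X := by
  have h : coboundary k Y f = 0 := hf
  show coboundary k X _ = 0
  rw [Cochain.coboundary_pullback, h, map_zero]

theorem Cochain.pullback_mem_coboundaries {k : ℕ} (u : C(X, Y)) (f : Cochain k Y)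
    (hf : f ∈ coboundaries k Y) : Cochain.pullback k u f ∈ coboundaries k X := by
  cases k with
  | zero =>
    have h : f = 0 := hf
    rw [h, map_zero]
    exact Submodule.zero_mem _
  | succ k =>
    obtain ⟨g, rfl⟩ := hf
    exact ⟨Cochain.pullback k u g, rfl⟩

/-- The map induced in cohomology by a continuous map. -/
def Cohomology.pullback (k : ℕ) (u : C(X, Y)) : Cohomology k Y →ₗ[ZMod 2] Cohomology k X :=
  Submodule.mapQ _ _
    ((Cochain.pullback k u).restrict fun f hf => Cochain.pullback_mem_cocycles u f hf)
    fun f hf => Cochain.pullback_mem_coboundaries u f.1 hf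

/-! ### Cup product -/

/-- The inclusion of the first `p + 1` vertices among `r + 1`. -/
def front {p q r : ℕ} (h : p + q = r) (i : Fin (p + 1)) : Fin (r + 1) := ⟨i, by omega⟩

/-- The inclusion of the last `q + 1` vertices among `r + 1`. -/
def back {p q r : ℕ} (h : p + q = r) (i : Fin (q + 1)) : Fin (r + 1) := ⟨p + i, by omega⟩

/-- The cup product of cochains: front face times back face. -/
def Cochain.cup {p q r : ℕ} (h : p + q = r) (f : Cochain p X) (g : Cochain q X) : Cochain r X :=
  fun σ => f (σ.pull (front h)) * g (σ.pull (back h))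

theorem Cochain.coboundary_cup {p q r : ℕ} (h : p + q = r) (f : Cochain p X) (g : Cochain q X) :
    coboundary r X (Cochain.cup h f g) =
      Cochain.cup (show (p + 1) + q = r + 1 by omega) (coboundary p X f) g +
      Cochain.cup (show p + (q + 1) = r + 1 by omega) f (coboundary q X g) := by
  subst h
  funext σ
  simp only [coboundary, Cochain.cup, LinearMap.coe_mk, AddHom.coe_mk, Pi.add_apply,
    Finset.sum_mul, Finset.mul_sum, Simplex.pull_pull]
  have hN : (p + 1) + (q + 1) = p + q + 2 := by omega
  rw [← (finCongr hN).sum_comp, Fin.sum_univ_add, Fin.sum_univ_castSucc (n := p + 1),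
    Fin.sum_univ_succ (n := q + 1)]
  have key : ∀ a b c d a' b' : ZMod 2, a = a' → b = b' → c = d → a + b = (a' + c) + (d + b') := by
    decide
  apply key
  · refine Finset.sum_congr rfl fun i _ => ?_
    congr 3
    · funext j
      ext
      simp only [front, Fin.succAbove, Fin.lt_def, Function.comp_apply]
      simp
      split_ifs <;> simp
    · funext j
      have := i.2
      ext
      simp only [back, Fin.succAbove, Fin.lt_def, Function.comp_apply]
      simp
      split_ifs <;> simp <;> omega
  · refine Finset.sum_congr rfl fun i _ => ?_
    congr 3
    · funext j
      have := j.2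
      ext
      simp only [front, Fin.succAbove, Fin.lt_def, Function.comp_apply]
      simp
      rw [if_pos (by omega)]
    · funext j
      ext
      simp only [back, Fin.succAbove, Fin.lt_def, Function.comp_apply]
      simp
      split_ifs <;> simp <;> omega
  · congr 3
    · funext j
      have := j.2
      ext
      simp only [front, Fin.succAbove, Fin.lt_def, Function.comp_apply]
      simp
      rw [if_pos (by omega)]
      rfl
    · funext j
      ext
      simp only [back, Fin.succAbove, Fin.lt_def, Function.comp_apply]
      simp
      omega

theorem Cochain.cup_mem_cocycles {p q r : ℕ} (h : p + q = r) {f : Cochain p X} {g : Cochain q X}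
    (hf : f ∈ cocycles p X) (hg : g ∈ cocycles q X) : Cochain.cup h f g ∈ cocycles r X := by
  have hf' : coboundary p X f = 0 := hf
  have hg' : coboundary q X g = 0 := hg
  show coboundary r X _ = 0
  rw [Cochain.coboundary_cup, hf', hg']
  funext σ
  simp [Cochain.cup]

theorem Cochain.cup_mem_coboundaries_left {p q r : ℕ} (h : p + q = r) {f : Cochain p X}
    {g : Cochain q X} (hf : f ∈ coboundaries p X) (hg : g ∈ cocycles q X) :
    Cochain.cup h f g ∈ coboundaries r X := by
  have hg' : coboundary q X g = 0 := hg
  cases p with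
  | zero =>
    have h0 : f = 0 := hf
    have : Cochain.cup h f g = 0 := by
      funext σ
      simp [Cochain.cup, h0]
    rw [this]
    exact Submodule.zero_mem _
  | succ p =>
    obtain ⟨u, rfl⟩ := hf
    obtain ⟨r, rfl⟩ : ∃ r', r = r' + 1 := ⟨p + q, by omega⟩
    refine ⟨Cochain.cup (show p + q = r by omega) u g, ?_⟩
    rw [Cochain.coboundary_cup, hg']
    funext σ
    simp [Cochain.cup]

theorem Cochain.cup_mem_coboundaries_right {p q r : ℕ} (h : p + q = r) {f : Cochain p X}
    {g : Cochain q X} (hf : f ∈ cocycles p X) (hg : g ∈ coboundaries q X) :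
    Cochain.cup h f g ∈ coboundaries r X := by
  have hf' : coboundary p X f = 0 := hf
  cases q with
  | zero =>
    have h0 : g = 0 := hg
    have : Cochain.cup h f g = 0 := by
      funext σ
      simp [Cochain.cup, h0]
    rw [this]
    exact Submodule.zero_mem _
  | succ q =>
    obtain ⟨u, rfl⟩ := hg
    obtain ⟨r, rfl⟩ : ∃ r', r = r' + 1 := ⟨p + q, by omega⟩
    refine ⟨Cochain.cup (show p + q = r by omega) f u, ?_⟩
    rw [Cochain.coboundary_cup, hf']
    funext σ
    simp [Cochain.cup]

/-- The cup product of cohomology classes. -/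
def Cohomology.cup {p q r : ℕ} (h : p + q = r) (a : Cohomology p X) (b : Cohomology q X) :
    Cohomology r X :=
  Quotient.liftOn₂' a b
    (fun f g => classOf ⟨Cochain.cup h f.1 g.1, Cochain.cup_mem_cocycles h f.2 g.2⟩) <| by
    intro f g f' g' hf hg
    rw [Submodule.quotientRel_def] at hf hg
    refine (Submodule.Quotient.eq _).2 ?_
    have e : Cochain.cup h f.1 g.1 - Cochain.cup h f'.1 g'.1 =
        Cochain.cup h (f.1 - f'.1) g.1 + Cochain.cup h f'.1 (g.1 - g'.1) := by
      funext σ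
      simp only [Cochain.cup, Pi.sub_apply, Pi.add_apply]
      ring
    show Cochain.cup h f.1 g.1 - Cochain.cup h f'.1 g'.1 ∈ coboundaries r X
    rw [e]
    exact Submodule.add_mem _ (Cochain.cup_mem_coboundaries_left h hf g.2)
      (Cochain.cup_mem_coboundaries_right h f'.2 hg)

/-- The unit of the cohomology ring: the class of the constant 0-cochain `1`. -/
def Cohomology.one (X : Type*) [TopologicalSpace X] : Cohomology 0 X :=
  classOf ⟨fun _ => 1, by
    show coboundary 0 X _ = 0
    funext σ
    show ∑ _i : Fin 2, (1 : ZMod 2) = 0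
    decide⟩

/-- The cup product `α 0 ⌣ α 1 ⌣ ⋯ ⌣ α (k - 1)` of `k` classes of degree one. -/
def Cohomology.cupProd : (k : ℕ) → (Fin k → Cohomology 1 X) → Cohomology k X
  | 0, _ => Cohomology.one X
  | k + 1, α => Cohomology.cup rfl (Cohomology.cupProd k (Fin.init α)) (α (Fin.last k))

end

end SingularMod2

/-! ## Finite simplicial complexes, systoles and cuts -/

namespace SimplicialSystole

open SingularMod2

variable {V : Type*} [Fintype V] [LinearOrder V]

/-- The geometric realization: points given by barycentric coordinates whose support is a face. -/
def realization (M : PreAbstractSimplicialComplex V) : Set (V → ℝ) :=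
  {x | x ∈ stdSimplex ℝ V ∧ Finset.univ.filter (fun v => x v ≠ 0) ∈ M.faces}

/-- The `k`-simplices of `M`: the faces with `k + 1` vertices. -/
def simplices (M : PreAbstractSimplicialComplex V) (k : ℕ) : Set (Finset V) :=
  {s | s ∈ M.faces ∧ s.card = k + 1}

/-- Every simplex of `M` has dimension at most `n`. -/
def DimLE (M : PreAbstractSimplicialComplex V) (n : ℕ) : Prop :=
  ∀ s ∈ M.faces, s.card ≤ n + 1

/-- The number of `n`-simplices of `M`. -/
def vol (n : ℕ) (M : PreAbstractSimplicialComplex V) : ℕ := (simplices M n).ncard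

theorem map_mem_realization (M : PreAbstractSimplicialComplex V) {k : ℕ} {s : Finset V}
    (hs : s ∈ M.faces) {φ : Fin (k + 1) → V} (hφ : ∀ i, φ i ∈ s) (x : stdSimplex ℝ (Fin (k + 1))) :
    (stdSimplex.map φ x : V → ℝ) ∈ realization M := by
  refine ⟨(stdSimplex.map φ x).2, (M.isRelLowerSet_faces hs).2 ?_ ?_⟩
  · intro v hv
    by_contra hvs
    refine (Finset.mem_filter.1 hv).2 ?_
    rw [stdSimplex.map_coe, FunOnFinite.linearMap_apply_apply]
    refine Finset.sum_eq_zero fun i hi => ?_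
    exact absurd ((Finset.mem_filter.1 hi).2 ▸ hφ i) hvs
  · by_contra hne
    rw [Finset.not_nonempty_iff_eq_empty, Finset.filter_eq_empty_iff] at hne
    have h1 := stdSimplex.sum_eq_one (stdSimplex.map φ x)
    rw [Finset.sum_eq_zero fun v hv => not_not.1 (hne hv)] at h1
    exact zero_ne_one h1

/-- A `k`-simplex of `M` as a singular simplex of the realization: the affine map that sends the
vertices of the standard simplex to the vertices of `s` in increasing order. -/
def toSingular (M : PreAbstractSimplicialComplex V) {k : ℕ} (s : simplices M k) :
    Simplex k (realization M) where
  toFun x := ⟨stdSimplex.map (s.1.orderEmbOfFin s.2.2) x,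
    map_mem_realization M s.2.1 (fun i => s.1.orderEmbOfFin_mem s.2.2 i) x⟩
  continuous_toFun := Continuous.subtype_mk
    (continuous_subtype_val.comp (stdSimplex.continuous_map _)) _

/-- A set of `k`-simplices is a `k`-cycle modulo 2 if every `(k - 1)`-simplex lies in an even
number of them (for `k = 0` there is no condition). -/
def IsCycle {M : PreAbstractSimplicialComplex V} {k : ℕ} (c : Finset (simplices M k)) : Prop :=
  ∀ t : Finset V, t.Nonempty → t.card = k → Even (c.filter fun s => t ⊆ s.1).card

/-- The value of a singular cochain on the simplicial chain `c`. -/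
def evalChain {M : PreAbstractSimplicialComplex V} {k : ℕ} (c : Finset (simplices M k)) :
    Cochain k (realization M) →ₗ[ZMod 2] ZMod 2 where
  toFun f := ∑ s ∈ c, f (toSingular M s)
  map_add' f g := by simp [Finset.sum_add_distrib]
  map_smul' a f := by simp [Finset.mul_sum]

theorem toSingular_face (M : PreAbstractSimplicialComplex V) {k : ℕ} (s : simplices M (k + 1))
    (i : Fin (k + 2)) (h : s.1.erase (s.1.orderEmbOfFin s.2.2 i) ∈ simplices M k) :
    (toSingular M s).pull i.succAbove = toSingular M ⟨_, h⟩ := by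
  have e : (s.1.orderEmbOfFin s.2.2 : Fin (k + 2) → V) ∘ i.succAbove =
      (s.1.erase (s.1.orderEmbOfFin s.2.2 i)).orderEmbOfFin h.2 := by
    refine Finset.orderEmbOfFin_unique h.2 (fun j => ?_) ?_
    · refine Finset.mem_erase.2 ⟨fun hj => ?_, s.1.orderEmbOfFin_mem s.2.2 _⟩
      exact Fin.succAbove_ne i j ((s.1.orderEmbOfFin s.2.2).injective hj)
    · exact (s.1.orderEmbOfFin s.2.2).strictMono.comp (Fin.strictMono_succAbove i)
  refine ContinuousMap.ext fun x => Subtype.ext ?_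
  show (stdSimplex.map _ (stdSimplex.map _ x) : V → ℝ) = stdSimplex.map _ x
  rw [stdSimplex.map_comp_apply]
  exact congrArg (fun φ : Fin (k + 1) → V => (stdSimplex.map φ x : V → ℝ)) e

theorem evalChain_coboundaries {M : PreAbstractSimplicialComplex V} {k : ℕ}
    {c : Finset (simplices M k)} (hc : IsCycle c) (f : Cochain k (realization M))
    (hf : f ∈ coboundaries k (realization M)) : evalChain c f = 0 := by
  classical
  cases k with
  | zero =>
    have h0 : f = 0 := hf
    rw [h0, map_zero]
  | succ k =>
    obtain ⟨g, rfl⟩ := hf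
    let G : Finset V → ZMod 2 := fun t =>
      if h : t ∈ simplices M k then g (toSingular M ⟨t, h⟩) else 0
    have key : ∀ s : simplices M (k + 1), coboundary k _ g (toSingular M s) =
        ∑ t ∈ (Finset.univ : Finset V).powersetCard (k + 1), if t ⊆ s.1 then G t else 0 := by
      intro s
      have herase : ∀ i : Fin (k + 2),
          s.1.erase (s.1.orderEmbOfFin s.2.2 i) ∈ simplices M k := by
        intro i
        have hcard : (s.1.erase (s.1.orderEmbOfFin s.2.2 i)).card = k + 1 := by
          rw [Finset.card_erase_of_mem (s.1.orderEmbOfFin_mem s.2.2 i), s.2.2]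
          rfl
        exact ⟨(M.isRelLowerSet_faces s.2.1).2 (Finset.erase_subset _ _)
          (Finset.card_pos.1 (by omega)), hcard⟩
      rw [← Finset.sum_filter]
      show ∑ i : Fin (k + 2), g ((toSingular M s).pull i.succAbove) = _
      refine Finset.sum_bij (fun i _ => s.1.erase (s.1.orderEmbOfFin s.2.2 i)) ?_ ?_ ?_ ?_
      · intro i _
        exact Finset.mem_filter.2 ⟨Finset.mem_powersetCard.2
          ⟨Finset.subset_univ _, (herase i).2⟩, Finset.erase_subset _ _⟩
      · intro i _ j _ hij
        have := (Finset.erase_inj s.1 (s.1.orderEmbOfFin_mem s.2.2 i)).1 hij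
        exact (s.1.orderEmbOfFin s.2.2).injective this
      · intro t ht
        obtain ⟨ht1, hts⟩ := Finset.mem_filter.1 ht
        have htc := (Finset.mem_powersetCard.1 ht1).2
        obtain ⟨v, hv⟩ : ∃ v, s.1 \ t = {v} := by
          rw [← Finset.card_eq_one, Finset.card_sdiff_of_subset hts, s.2.2, htc]
          omega
        have hvs : v ∈ s.1 := (Finset.mem_sdiff.1 (hv ▸ Finset.mem_singleton_self v)).1
        obtain ⟨i, hi⟩ : v ∈ Set.range (s.1.orderEmbOfFin s.2.2) := by
          rw [Finset.range_orderEmbOfFin]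
          exact hvs
        refine ⟨i, Finset.mem_univ i, ?_⟩
        rw [hi, Finset.erase_eq, ← hv, Finset.sdiff_sdiff_eq_self hts]
      · intro i _
        rw [toSingular_face M s i (herase i)]
        simp only [G]
        rw [dif_pos (herase i)]
    show ∑ s ∈ c, coboundary k _ g (toSingular M s) = 0
    rw [Finset.sum_congr rfl fun s _ => key s, Finset.sum_comm]
    refine Finset.sum_eq_zero fun t ht => ?_
    have htc := (Finset.mem_powersetCard.1 ht).2
    rw [← Finset.sum_filter, Finset.sum_const, nsmul_eq_mul,
      (ZMod.natCast_eq_zero_iff_even).2 (hc t (Finset.card_pos.1 (by omega)) htc), zero_mul]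

/-- The value of a cohomology class on (the homology class of) a simplicial cycle. -/
def pairing {M : PreAbstractSimplicialComplex V} {k : ℕ} (c : Finset (simplices M k))
    (hc : IsCycle c) : Cohomology k (realization M) →ₗ[ZMod 2] ZMod 2 :=
  Submodule.liftQ _ ((evalChain c).comp (cocycles k (realization M)).subtype)
    fun f hf => evalChain_coboundaries hc f.1 hf

/-- The systole of `α`: the minimal number of `k`-simplices in a simplicial `k`-cycle that is
detected by `α` (infinite if there is no such cycle). -/
def sys (M : PreAbstractSimplicialComplex V) {k : ℕ} (α : Cohomology k (realization M)) : ℕ∞ :=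
  ⨅ (c : Finset (simplices M k)) (hc : IsCycle c) (_ : pairing c hc α ≠ 0), (c.card : ℕ∞)

/-- `H` cuts `α`: the restriction of `α` to the complement of `H` in `M`, taken in the geometric
realizations, is zero. -/
def Cuts (M H : PreAbstractSimplicialComplex V) {k : ℕ} (α : Cohomology k (realization M)) :
    Prop :=
  Cohomology.pullback k
    (ContinuousMap.inclusion (Set.sdiff_subset : realization M \ realization H ⊆ realization M))
    α = 0

/-- For an `n`-dimensional complex `M` and a class `α` of degree `k`, the minimal number of
`(n - k)`-simplices in a subcomplex `H` of dimension at most `n - k` that cuts `α` (infinite if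
there is no such `H`). A simplex `s` has dimension `s.card - 1`, so "dimension at most `n - k`" is
written as `s.card + k ≤ n + 1`. -/
def cut (n : ℕ) (M : PreAbstractSimplicialComplex V) {k : ℕ} (α : Cohomology k (realization M)) :
    ℕ∞ :=
  ⨅ (H : PreAbstractSimplicialComplex V) (_ : H ≤ M) (_ : ∀ s ∈ H.faces, s.card + k ≤ n + 1)
    (_ : Cuts M H α), ({s | s ∈ H.faces ∧ s.card + k = n + 1} : Set (Finset V)).encard

end SimplicialSystole

end

/-! The proof cuts along one class at a time. Suppose a subcomplex `Z` of dimension at most `n - i`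
cuts the product of the first `i` classes, and let `f` be a cocycle for the next class, of systole
`σ`. Join two top simplices of `Z` by an edge when they share a codimension-one face. Closed chains
of fewer than `σ` edges have `f`-value zero, so `f` has a potential on every ball of this graph
whose radius is somewhat below `σ / 2`. A ball cannot double its number of simplices `L` times if
there are fewer than `2 ^ L` of them. Hence some admissible radius gives a ball with few boundary
faces, a fraction of order `L / σ` of its simplices (`exists_radius`). Carving off such balls one
after another (`exists_carving`) removes a set `E` of codimension-one faces with `σ * E.card ≤ 10 *
L * (n + 1) * N`, where `N` counts the top simplices of `Z`. The next subcomplex consists of `E` and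
the faces of `Z` of codimension at least two (`exists_cut_subcomplex`). After `k` steps the product
of the systoles and the number of top simplices is at most `(10 * L * (n + 1)) ^ k` times the volume
(`exists_iterated_cut`). Since `L` can be taken of logarithmic size, the extra factor is absorbed by
the power `ε`.

It remains to see that the last subcomplex `H` cuts the product (`cuts_cupProd`). Every face outside
`H` was discarded at some step `i`, and the cocycle of that step has a potential on the faces
discarded then. The open stars of the barycentres of all discarded faces cover the complement of
`H`. Two such stars meet only if the faces are nested, so the potentials of one step glue to a
primitive (`exists_primitive`). Subtracting its coboundary makes the `i`-th cocycle vanish on paths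
inside these stars. The cup product of the corrected cocycles then vanishes on every singular
simplex lying in one star, and barycentric subdivision shows that it is a coboundary
(`mem_coboundaries_of_small`). -/

noncomputable section

namespace SingularMod2

/-! ### Subdivision of functions on tuples -/

section Tuple

variable {E : Type*}

/-- The coboundary of a function on `(k + 1)`-tuples. -/
def tupleCoboundary {k : ℕ} (φ : (Fin (k + 1) → E) → ZMod 2) (p : Fin (k + 2) → E) : ZMod 2 :=
  ∑ i : Fin (k + 2), φ (p ∘ i.succAbove)

/-- Evaluate a function of tuples on the cone with apex `b`. -/
def tupleCone {k : ℕ} (b : E) (φ : (Fin (k + 2) → E) → ZMod 2) (p : Fin (k + 1) → E) : ZMod 2 :=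
  φ (Fin.cons b p : Fin (k + 2) → E)

/-- The dual of the barycentric subdivision, with respect to a choice `b` of barycentres. -/
def tupleSubdiv (b : ∀ k : ℕ, (Fin (k + 1) → E) → E) :
    (k : ℕ) → ((Fin (k + 1) → E) → ZMod 2) → (Fin (k + 1) → E) → ZMod 2
  | 0, φ => φ
  | k + 1, φ => fun p => ∑ i : Fin (k + 2),
      tupleSubdiv b k (tupleCone (b (k + 1) p) φ) (p ∘ i.succAbove)

/-- The dual of the chain homotopy between the barycentric subdivision and the identity. -/
def tupleHomotopy (b : ∀ k : ℕ, (Fin (k + 1) → E) → E) :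
    (k : ℕ) → ((Fin (k + 2) → E) → ZMod 2) → (Fin (k + 1) → E) → ZMod 2
  | 0, _ => 0
  | k + 1, φ => fun p => tupleCone (b (k + 1) p) φ p + ∑ i : Fin (k + 2),
      tupleHomotopy b k (tupleCone (b (k + 1) p) φ) (p ∘ i.succAbove)

theorem tupleCone_add {k : ℕ} (b : E) (φ ψ : (Fin (k + 2) → E) → ZMod 2) :
    tupleCone b (φ + ψ) = tupleCone b φ + tupleCone b ψ := rfl

theorem tupleSubdiv_add (b : ∀ k : ℕ, (Fin (k + 1) → E) → E) (k : ℕ)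
    (φ ψ : (Fin (k + 1) → E) → ZMod 2) :
    tupleSubdiv b k (φ + ψ) = tupleSubdiv b k φ + tupleSubdiv b k ψ := by
  induction k with
  | zero => rfl
  | succ k ih =>
    funext p
    simp only [tupleSubdiv, tupleCone_add, ih, Pi.add_apply, Finset.sum_add_distrib]

theorem tupleHomotopy_add (b : ∀ k : ℕ, (Fin (k + 1) → E) → E) (k : ℕ)
    (φ ψ : (Fin (k + 2) → E) → ZMod 2) :
    tupleHomotopy b k (φ + ψ) = tupleHomotopy b k φ + tupleHomotopy b k ψ := by
  induction k with
  | zero => simp [tupleHomotopy]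
  | succ k ih =>
    funext p
    simp only [tupleHomotopy, tupleCone_add, ih, Pi.add_apply, Finset.sum_add_distrib]
    ring

theorem tupleHomotopy_zero (b : ∀ k : ℕ, (Fin (k + 1) → E) → E) (k : ℕ) :
    tupleHomotopy b k 0 = 0 := by
  have h := tupleHomotopy_add b k 0 0
  rw [add_zero] at h
  exact left_eq_add.1 h

/-- Deleting two entries in either order gives the same tuple, so the terms cancel in pairs modulo
2. -/
theorem tupleCoboundary_tupleCoboundary {k : ℕ} (φ : (Fin (k + 1) → E) → ZMod 2) :
    tupleCoboundary (tupleCoboundary φ) = 0 := by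
  funext p
  simp only [tupleCoboundary, Pi.zero_apply]
  rw [← Finset.sum_product' Finset.univ Finset.univ
    (fun (i : Fin (k + 3)) (j : Fin (k + 2)) => φ ((p ∘ i.succAbove) ∘ j.succAbove))]
  refine Finset.sum_involution (fun x _ => (x.1.succAbove x.2, x.2.predAbove x.1)) ?_ ?_ ?_ ?_
  · rintro ⟨i, j⟩ -
    have : (p ∘ (i.succAbove j).succAbove) ∘ (j.predAbove i).succAbove =
        (p ∘ i.succAbove) ∘ j.succAbove := by
      funext l
      simp only [Function.comp_apply]
      rw [Fin.succAbove_succAbove_succAbove_predAbove]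
    rw [this]
    exact CharTwo.add_self_eq_zero _
  · rintro ⟨i, j⟩ - - h
    exact Fin.succAbove_ne i j (congrArg Prod.fst h)
  · intros
    simp
  · rintro ⟨i, j⟩ -
    simp [Fin.succAbove_succAbove_predAbove, Fin.predAbove_predAbove_succAbove]

theorem cons_comp_succAbove_zero {k : ℕ} (b : E) (p : Fin (k + 1) → E) :
    (Fin.cons b p : Fin (k + 2) → E) ∘ (0 : Fin (k + 2)).succAbove = p := by
  funext j
  simp

theorem cons_comp_succAbove_succ {k : ℕ} (b : E) (p : Fin (k + 2) → E) (i : Fin (k + 2)) :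
    (Fin.cons b p : Fin (k + 3) → E) ∘ i.succ.succAbove =
      (Fin.cons b (p ∘ i.succAbove) : Fin (k + 2) → E) := by
  funext j
  refine Fin.cases ?_ (fun j => ?_) j <;> simp

theorem tupleCone_tupleCoboundary {k : ℕ} (b : E) (φ : (Fin (k + 2) → E) → ZMod 2) :
    tupleCone b (tupleCoboundary φ) = φ + tupleCoboundary (tupleCone b φ) := by
  funext p
  simp only [tupleCone, tupleCoboundary, Pi.add_apply]
  rw [Fin.sum_univ_succ, cons_comp_succAbove_zero]
  simp only [cons_comp_succAbove_succ]

/-- In degree zero the cone formula has an extra term at the apex: the cone on a point has the apex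
as its other face. -/
theorem tupleCone_tupleCoboundary_zero (b : E) (φ : (Fin 1 → E) → ZMod 2) (p : Fin 1 → E) :
    tupleCone b (tupleCoboundary φ) p = φ p + φ (fun _ => b) := by
  simp only [tupleCone, tupleCoboundary]
  rw [Fin.sum_univ_two, cons_comp_succAbove_zero]
  congr 2
  funext j
  obtain rfl : j = 0 := Fin.fin_one_eq_zero j
  rfl

variable (b : ∀ k : ℕ, (Fin (k + 1) → E) → E)

/-- By the cone formula, the subdivided coboundary at `p` is the wanted term plus a double
coboundary; the apex stays fixed while the faces of `p` vary. In the lowest degree the two apex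
terms cancel. -/
theorem tupleSubdiv_tupleCoboundary (k : ℕ) (φ : (Fin (k + 1) → E) → ZMod 2) :
    tupleSubdiv b (k + 1) (tupleCoboundary φ) = tupleCoboundary (tupleSubdiv b k φ) := by
  induction k with
  | zero =>
    funext p
    show ∑ i, tupleCone _ (tupleCoboundary φ) _ = ∑ i, φ _
    simp only [tupleCone_tupleCoboundary_zero, Finset.sum_add_distrib, Finset.sum_const]
    simp [CharTwo.two_eq_zero]
  | succ k ih =>
    funext p
    rw [tupleSubdiv]
    simp only [tupleCone_tupleCoboundary, tupleSubdiv_add, ih, Pi.add_apply,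
      Finset.sum_add_distrib]
    have h := congrFun (tupleCoboundary_tupleCoboundary
      (tupleSubdiv b k (tupleCone (b (k + 2) p) φ))) p
    rw [Pi.zero_apply] at h
    rw [tupleCoboundary] at h
    rw [h, add_zero]
    rfl

/-- Induction with the cone formula: apply the identity one degree lower to the cones over the faces
of `p`; what is left over is again a double coboundary. -/
theorem tupleHomotopy_tupleCoboundary (k : ℕ) (φ : (Fin (k + 2) → E) → ZMod 2) :
    tupleHomotopy b (k + 1) (tupleCoboundary φ) + tupleCoboundary (tupleHomotopy b k φ) =
      φ + tupleSubdiv b (k + 1) φ := by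
  induction k with
  | zero =>
    funext p
    simp only [tupleHomotopy, tupleCoboundary, Pi.add_apply, tupleSubdiv, Pi.zero_apply,
      Finset.sum_const_zero, add_zero]
    have := congrFun (tupleCone_tupleCoboundary (b 1 p) φ) p
    simpa [tupleCoboundary] using this
  | succ k ih =>
    have ih' : ∀ ψ : (Fin (k + 2) → E) → ZMod 2, tupleHomotopy b (k + 1) (tupleCoboundary ψ) =
        ψ + tupleSubdiv b (k + 1) ψ + tupleCoboundary (tupleHomotopy b k ψ) := by
      intro ψ
      funext p
      simp only [← ih ψ, Pi.add_apply, add_assoc, CharTwo.add_self_eq_zero, add_zero]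
    funext p
    have h := congrFun (tupleCoboundary_tupleCoboundary
      (tupleHomotopy b k (tupleCone (b (k + 2) p) φ))) p
    rw [Pi.zero_apply, tupleCoboundary] at h
    rw [Pi.add_apply, tupleHomotopy]
    simp only [tupleCone_tupleCoboundary, tupleHomotopy_add, ih', Pi.add_apply,
      Finset.sum_add_distrib, h]
    simp only [tupleCoboundary, tupleSubdiv]
    have key : ∀ a b c d : ZMod 2, a + b + (c + (b + d + 0)) + c = a + d := by decide
    exact key _ _ _ _

/-- Naturality of the subdivision under maps that preserve the chosen barycentres. -/
theorem tupleSubdiv_comp {E' : Type*} (b' : ∀ k : ℕ, (Fin (k + 1) → E') → E') (A : E' → E)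
    (hA : ∀ (k : ℕ) (p : Fin (k + 1) → E'), b k (A ∘ p) = A (b' k p)) (k : ℕ)
    (φ : (Fin (k + 1) → E) → ZMod 2) (p : Fin (k + 1) → E') :
    tupleSubdiv b' k (fun q => φ (A ∘ q)) p = tupleSubdiv b k φ (A ∘ p) := by
  induction k with
  | zero => rfl
  | succ k ih =>
    simp only [tupleSubdiv]
    refine Finset.sum_congr rfl fun i _ => ?_
    rw [hA, Function.comp_assoc, ← ih]
    congr 1
    funext q
    simp only [tupleCone, Fin.comp_cons]

theorem tupleHomotopy_comp {E' : Type*} (b' : ∀ k : ℕ, (Fin (k + 1) → E') → E') (A : E' → E)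
    (hA : ∀ (k : ℕ) (p : Fin (k + 1) → E'), b k (A ∘ p) = A (b' k p)) (k : ℕ)
    (φ : (Fin (k + 2) → E) → ZMod 2) (p : Fin (k + 1) → E') :
    tupleHomotopy b' k (fun q => φ (A ∘ q)) p = tupleHomotopy b k φ (A ∘ p) := by
  induction k with
  | zero => rfl
  | succ k ih =>
    simp only [tupleHomotopy]
    congr 1
    · simp only [tupleCone, hA, Fin.comp_cons]
    refine Finset.sum_congr rfl fun i _ => ?_
    rw [hA, Function.comp_assoc, ← ih]
    congr 1
    funext q
    simp only [tupleCone, Fin.comp_cons]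

end Tuple

end SingularMod2

namespace SingularMod2

/-! ### Affine simplices -/

section Combo

variable {ι κ ν : Type*} [Fintype ι] [Fintype κ] [Fintype ν]

/-- The convex combination of the points `p i` with weights `w i`. -/
def combo (p : ι → stdSimplex ℝ κ) (w : stdSimplex ℝ ι) : stdSimplex ℝ κ :=
  ⟨fun v => ∑ i, w i * p i v, fun v => Finset.sum_nonneg fun i _ =>
      mul_nonneg (w.2.1 i) ((p i).2.1 v), by
    rw [Finset.sum_comm]
    simp only [← Finset.mul_sum]
    rw [← w.2.2]
    refine Finset.sum_congr rfl fun i _ => ?_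
    have h : ∑ v, p i v = 1 := (p i).2.2
    rw [h, mul_one]
    rfl⟩

theorem combo_apply (p : ι → stdSimplex ℝ κ) (w : stdSimplex ℝ ι) (v : κ) :
    combo p w v = ∑ i, w i * p i v := rfl

theorem continuous_combo (p : ι → stdSimplex ℝ κ) : Continuous (combo p) := by
  refine Continuous.subtype_mk (continuous_pi fun v => ?_) _
  refine continuous_finsetSum _ fun i _ => Continuous.mul ?_ continuous_const
  exact (continuous_apply i).comp continuous_subtype_val

theorem combo_combo (p : ι → stdSimplex ℝ κ) (q : ν → stdSimplex ℝ ι) (w : stdSimplex ℝ ν) :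
    combo p (combo q w) = combo (combo p ∘ q) w := by
  ext v
  simp only [combo_apply, Function.comp_apply, Finset.sum_mul, Finset.mul_sum]
  rw [Finset.sum_comm]
  exact Finset.sum_congr rfl fun i _ => Finset.sum_congr rfl fun j _ => by ring

theorem combo_vertex [DecidableEq ι] (p : ι → stdSimplex ℝ κ) (i : ι) :
    combo p (stdSimplex.vertex i) = p i := by
  ext v
  simp [combo_apply, Pi.single_apply]

theorem vertex_combo [DecidableEq ι] (w : stdSimplex ℝ ι) :
    combo (fun i => stdSimplex.vertex i) w = w := by
  ext v
  simp [combo_apply, Pi.single_apply]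

theorem combo_map (p : ι → stdSimplex ℝ κ) (φ : ν → ι) (w : stdSimplex ℝ ν) :
    combo p (stdSimplex.map φ w) = combo (p ∘ φ) w := by
  classical
  ext v
  simp only [combo_apply, Function.comp_apply, stdSimplex.map_coe,
    FunOnFinite.linearMap_apply_apply, Finset.sum_mul]
  rw [← Finset.sum_fiberwise Finset.univ φ (fun i => w i * p (φ i) v)]
  refine Finset.sum_congr rfl fun i _ => Finset.sum_congr rfl fun j hj => ?_
  rw [(Finset.mem_filter.1 hj).2]

theorem combo_vertex_comp [DecidableEq ι] (φ : ν → ι) (w : stdSimplex ℝ ν) :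
    combo (fun j => stdSimplex.vertex (φ j)) w = stdSimplex.map φ w := by
  rw [← vertex_combo (stdSimplex.map φ w), combo_map]
  rfl

/-- The affine simplex with prescribed vertices, as a continuous map. -/
def comboMap (p : ι → stdSimplex ℝ κ) : C(stdSimplex ℝ ι, stdSimplex ℝ κ) :=
  ⟨combo p, continuous_combo p⟩

theorem dist_combo_le (p : ι → stdSimplex ℝ κ) (w : stdSimplex ℝ ι) (x : stdSimplex ℝ κ) {d : ℝ}
    (hd : 0 ≤ d) (h : ∀ i, dist (p i) x ≤ d) : dist (combo p w) x ≤ d := by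
  refine (dist_pi_le_iff hd).2 fun v => ?_
  have h1 : ∀ i, |p i v - x v| ≤ d := fun i => (dist_pi_le_iff hd).1 (h i) v
  have hw : ∑ i, w i = 1 := w.2.2
  have e : combo p w v - x v = ∑ i, w i * (p i v - x v) := by
    rw [combo_apply]
    simp only [mul_sub, Finset.sum_sub_distrib, ← Finset.sum_mul, hw, one_mul]
  show |combo p w v - x v| ≤ d
  rw [e]
  refine (Finset.abs_sum_le_sum_abs _ _).trans ?_
  have hb : ∀ i ∈ Finset.univ, |w i * (p i v - x v)| ≤ w i * d := fun i _ => by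
    have hi : 0 ≤ w i := w.2.1 i
    rw [abs_mul, abs_of_nonneg hi]
    exact mul_le_mul_of_nonneg_left (h1 i) hi
  refine (Finset.sum_le_sum hb).trans ?_
  rw [← Finset.sum_mul, hw, one_mul]

/-- The centre of the standard simplex. -/
def simplexCenter (k : ℕ) : stdSimplex ℝ (Fin (k + 1)) :=
  ⟨fun _ => ((k : ℝ) + 1)⁻¹, fun _ => by positivity, by
    simp only [Finset.sum_const, Finset.card_univ, Fintype.card_fin, nsmul_eq_mul]
    push_cast
    exact mul_inv_cancel₀ (by positivity)⟩

/-- The barycentre of the vertices of an affine simplex. -/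
def barycenter (κ : Type*) [Fintype κ] (k : ℕ) (p : Fin (k + 1) → stdSimplex ℝ κ) :
    stdSimplex ℝ κ :=
  combo p (simplexCenter k)

theorem barycenter_combo (p : ι → stdSimplex ℝ κ) (k : ℕ) (q : Fin (k + 1) → stdSimplex ℝ ι) :
    barycenter κ k (combo p ∘ q) = combo p (barycenter ι k q) :=
  (combo_combo p q _).symm

/-- The term of `p j` itself drops out of the mean of the differences, leaving `k` of the `k + 1`
equal weights. -/
theorem dist_barycenter_le {k : ℕ} (p : Fin (k + 1) → stdSimplex ℝ κ) {D : ℝ} (hD : 0 ≤ D)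
    (h : ∀ i j, dist (p i) (p j) ≤ D) (j : Fin (k + 1)) :
    dist (p j) (barycenter κ k p) ≤ (k : ℝ) / (k + 1) * D := by
  refine (dist_pi_le_iff (by positivity)).2 fun v => ?_
  rw [dist_comm]
  have h1 : ∀ i, |p i v - p j v| ≤ D := fun i => (dist_pi_le_iff hD).1 (h i j) v
  have hk : (k : ℝ) + 1 ≠ 0 := by positivity
  have e : barycenter κ k p v - p j v =
      ∑ i ∈ Finset.univ.erase j, ((k : ℝ) + 1)⁻¹ * (p i v - p j v) := by
    have h0 : barycenter κ k p v = ∑ i, ((k : ℝ) + 1)⁻¹ * p i v := rfl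
    rw [Finset.sum_erase _ (by simp), h0]
    simp only [mul_sub, Finset.sum_sub_distrib, Finset.sum_const, Finset.card_univ,
      Fintype.card_fin, nsmul_eq_mul]
    push_cast
    field_simp
  show |barycenter κ k p v - p j v| ≤ _
  rw [e]
  refine (Finset.abs_sum_le_sum_abs _ _).trans ?_
  have hb : ∀ i ∈ Finset.univ.erase j,
      |((k : ℝ) + 1)⁻¹ * (p i v - p j v)| ≤ ((k : ℝ) + 1)⁻¹ * D := fun i _ => by
    have hi : (0 : ℝ) ≤ ((k : ℝ) + 1)⁻¹ := by positivity
    rw [abs_mul, abs_of_nonneg hi]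
    exact mul_le_mul_of_nonneg_left (h1 i) hi
  refine (Finset.sum_le_sum hb).trans ?_
  rw [Finset.sum_const, Finset.card_erase_of_mem (Finset.mem_univ j), Finset.card_univ,
    Fintype.card_fin, nsmul_eq_mul, Nat.add_sub_cancel, ← mul_assoc, div_eq_mul_inv]

/-- If a function vanishes on the tuples of points of the simplex spanned by `p` that have small
diameter, then its subdivision vanishes at `p`. -/
theorem tupleSubdiv_barycenter_eq_zero (N : ℕ) {D : ℝ} (hD : 0 ≤ D) (k : ℕ) (hk : k ≤ N)
    (φ : (Fin (k + 1) → stdSimplex ℝ κ) → ZMod 2) (p : Fin (k + 1) → stdSimplex ℝ κ)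
    (hp : ∀ i j, dist (p i) (p j) ≤ D)
    (hφ : ∀ q : Fin (k + 1) → stdSimplex ℝ κ, (∀ i, q i ∈ Set.range (combo p)) →
      (∀ i j, dist (q i) (q j) ≤ (N : ℝ) / (N + 1) * D) → φ q = 0) :
    tupleSubdiv (barycenter κ) k φ p = 0 := by
  induction k with
  | zero =>
    refine hφ p (fun i => ⟨_, combo_vertex p i⟩) fun i j => ?_
    obtain rfl : i = j := (Fin.fin_one_eq_zero i).trans (Fin.fin_one_eq_zero j).symm
    rw [dist_self]
    positivity
  | succ k ih =>
    rw [tupleSubdiv]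
    -- A tuple of the subdivision is the barycentre followed by a tuple of the subdivided face.
    -- Keeping `N` fixed makes the contraction ratio the same in every degree of the induction.
    refine Finset.sum_eq_zero fun i _ => ?_
    refine ih (by omega) _ _ (fun _ _ => hp _ _) fun q hq hqd => hφ _ ?_ ?_
    · have hq' : ∀ j, q j ∈ Set.range (combo p) := fun j => by
        obtain ⟨w, hw⟩ := hq j
        exact ⟨_, (combo_map p _ w).trans hw⟩
      refine Fin.cases ⟨simplexCenter (k + 1), rfl⟩ fun j => ?_
      simpa using hq' j
    · have hb : ∀ j, dist (q j) (barycenter κ (k + 1) p) ≤ (N : ℝ) / (N + 1) * D := fun j => by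
        obtain ⟨w, hw⟩ := hq j
        rw [← hw]
        refine dist_combo_le _ _ _ (by positivity) fun l =>
          (dist_barycenter_le p hD hp _).trans (mul_le_mul_of_nonneg_right ?_ hD)
        have : ((k + 1 : ℕ) : ℝ) ≤ N := by exact_mod_cast hk
        rw [div_le_div_iff₀ (by positivity) (by positivity)]
        linarith
      refine Fin.cases ?_ fun a => ?_
      · refine Fin.cases ?_ fun c => ?_
        · simp only [Fin.cons_zero, dist_self]
          positivity
        · simpa [dist_comm] using hb c
      · refine Fin.cases ?_ fun c => ?_
        · simpa using hb a
        · simpa using hqd a c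

/-- Each subdivision shrinks diameters by the factor `k / (k + 1) < 1`, so one number of iterations
serves all tuples. -/
theorem tupleSubdiv_iterate_eq_zero {k : ℕ} {δ : ℝ} (hδ : 0 < δ)
    (φ : (Fin (k + 1) → stdSimplex ℝ κ) → ZMod 2)
    (hφ : ∀ q : Fin (k + 1) → stdSimplex ℝ κ, (∀ i j, dist (q i) (q j) ≤ δ) → φ q = 0) :
    ∃ m₀ : ℕ, ∀ m ≥ m₀, ∀ p : Fin (k + 1) → stdSimplex ℝ κ,
      (tupleSubdiv (barycenter κ) k)^[m] φ p = 0 := by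
  set r : ℝ := (k : ℝ) / (k + 1) with hr
  have hr0 : 0 ≤ r := by positivity
  have hr1 : r < 1 := by
    rw [hr, div_lt_one (by positivity)]
    linarith
  have key : ∀ m : ℕ, ∀ D : ℝ, 0 ≤ D → r ^ m * D ≤ δ → ∀ p : Fin (k + 1) → stdSimplex ℝ κ,
      (∀ i j, dist (p i) (p j) ≤ D) → (tupleSubdiv (barycenter κ) k)^[m] φ p = 0 := by
    intro m
    induction m with
    | zero =>
      intro D _ h p hp
      exact hφ p fun i j => (hp i j).trans (by simpa using h)
    | succ m ih =>
      intro D hD h p hp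
      rw [Function.iterate_succ_apply']
      refine tupleSubdiv_barycenter_eq_zero k hD k le_rfl _ p hp fun q _ hq => ?_
      refine ih (r * D) (by positivity) ?_ q hq
      rwa [pow_succ, mul_assoc] at h
  obtain ⟨m₀, hm₀⟩ := exists_pow_lt_of_lt_one hδ hr1
  -- The standard simplex has diameter at most 1 in the supremum metric.
  refine ⟨m₀, fun m hm p => key m 1 zero_le_one ?_ p fun i j => ?_⟩
  · rw [mul_one]
    exact (pow_le_pow_of_le_one hr0 hr1.le hm).trans hm₀.le
  · refine (dist_pi_le_iff zero_le_one).2 fun v => ?_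
    have h1 := mem_Icc_of_mem_stdSimplex (p i).2 v
    have h2 := mem_Icc_of_mem_stdSimplex (p j).2 v
    rw [Real.dist_eq, abs_le]
    constructor <;> linarith [h1.1, h1.2, h2.1, h2.2]

end Combo

/-! ### Small simplices -/

section Small

variable {X : Type*} [TopologicalSpace X]

/-- The values of a cochain on the affine subsimplices of a singular simplex. -/
def tupleValue {n k : ℕ} (f : Cochain k X) (σ : Simplex n X)
    (p : Fin (k + 1) → stdSimplex ℝ (Fin (n + 1))) : ZMod 2 :=
  f (σ.comp (comboMap p))

theorem Simplex.pull_comp_comboMap {n k l : ℕ} (σ : Simplex n X)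
    (p : Fin (k + 1) → stdSimplex ℝ (Fin (n + 1))) (φ : Fin (l + 1) → Fin (k + 1)) :
    Simplex.pull (σ.comp (comboMap p)) φ = σ.comp (comboMap (p ∘ φ)) := by
  ext w
  exact congrArg σ (combo_map p φ w)

theorem tupleCoboundary_tupleValue {n k : ℕ} (f : Cochain k X) (σ : Simplex n X) :
    tupleCoboundary (tupleValue f σ) = tupleValue (coboundary k X f) σ := by
  funext p
  show ∑ i : Fin (k + 2), f _ = ∑ i : Fin (k + 2), f _
  simp only [Simplex.pull_comp_comboMap]

theorem tupleValue_pull {n m k : ℕ} (f : Cochain k X) (σ : Simplex n X)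
    (φ : Fin (m + 1) → Fin (n + 1)) (p : Fin (k + 1) → stdSimplex ℝ (Fin (m + 1))) :
    tupleValue f (σ.pull φ) p = tupleValue f σ (stdSimplex.map φ ∘ p) := by
  refine congrArg f (ContinuousMap.ext fun w => congrArg σ ?_)
  show stdSimplex.map φ (combo p w) = combo (stdSimplex.map φ ∘ p) w
  rw [← combo_vertex_comp, combo_combo]
  congr 1
  funext i
  exact combo_vertex_comp φ (p i)

theorem tupleValue_vertex {n : ℕ} (f : Cochain n X) (σ : Simplex n X) :
    tupleValue f σ (fun i => stdSimplex.vertex i) = f σ :=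
  congrArg f (ContinuousMap.ext fun w => congrArg σ (vertex_combo w))

/-- The barycentric subdivision commutes with restriction to a face. -/
theorem barycenter_map {n m : ℕ} (φ : Fin (m + 1) → Fin (n + 1)) (k : ℕ)
    (p : Fin (k + 1) → stdSimplex ℝ (Fin (m + 1))) :
    barycenter _ k (stdSimplex.map φ ∘ p) = stdSimplex.map φ (barycenter _ k p) := by
  have h : (stdSimplex.map φ : stdSimplex ℝ (Fin (m + 1)) → _) =
      combo fun j => stdSimplex.vertex (φ j) :=
    funext fun w => (combo_vertex_comp φ w).symm
  rw [h, barycenter_combo]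

/-- A singular simplex maps all sufficiently small affine subsimplices into members of a given
open cover. -/
theorem exists_small_combo {n : ℕ} {ι : Type*} (U : ι → Set X) (hU : ∀ i, IsOpen (U i))
    (hcov : ∀ x, ∃ i, x ∈ U i) (σ : Simplex n X) (k : ℕ) :
    ∃ δ > 0, ∀ q : Fin (k + 1) → stdSimplex ℝ (Fin (n + 1)), (∀ i j, dist (q i) (q j) ≤ δ) →
      ∃ i, ∀ x, σ (combo q x) ∈ U i := by
  obtain ⟨δ, hδ, h⟩ := lebesgue_number_lemma_of_metric (s := Set.univ)
    (c := fun i => σ ⁻¹' U i) isCompact_univ (fun i => (hU i).preimage σ.continuous)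
    (fun x _ => Set.mem_iUnion.2 (hcov (σ x)))
  refine ⟨δ / 2, by positivity, fun q hq => ?_⟩
  obtain ⟨i, hi⟩ := h (q 0) (Set.mem_univ _)
  refine ⟨i, fun x => hi (Metric.mem_ball.2 ?_)⟩
  exact (dist_combo_le _ _ _ (by positivity) fun j => hq _ _).trans_lt (by linarith)

theorem sum_range_telescope_charTwo (a : ℕ → ZMod 2) (m : ℕ) :
    ∑ l ∈ Finset.range m, (a l + a (l + 1)) = a 0 + a m := by
  induction m with
  | zero => simp [CharTwo.add_self_eq_zero]
  | succ m ih =>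
    rw [Finset.sum_range_succ, ih]
    have key : ∀ x y z : ZMod 2, x + y + (y + z) = x + z := by decide
    exact key _ _ _

/-- A cocycle that vanishes on all simplices subordinate to an open cover is a coboundary. -/
theorem mem_coboundaries_of_small {k : ℕ} {ι : Type*} (U : ι → Set X) (hU : ∀ i, IsOpen (U i))
    (hcov : ∀ x, ∃ i, x ∈ U i) (f : Cochain k X) (hf : f ∈ cocycles k X)
    (hsmall : ∀ (σ : Simplex k X) (i : ι), (∀ x, σ x ∈ U i) → f σ = 0) :
    f ∈ coboundaries k X := by
  cases k with
  | zero =>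
    refine (?_ : f = 0)
    funext σ
    obtain ⟨i, hi⟩ := hcov (σ (stdSimplex.vertex 0))
    refine hsmall σ i fun x => ?_
    have : x = stdSimplex.vertex 0 := by
      ext v
      have hx : ∑ i, x i = 1 := x.2.2
      rw [Fin.sum_univ_one] at hx
      obtain rfl : v = 0 := Fin.fin_one_eq_zero v
      exact hx.trans (by simp)
    rwa [this]
  | succ k =>
    let b : ∀ n k : ℕ, (Fin (k + 1) → stdSimplex ℝ (Fin (n + 1))) → stdSimplex ℝ (Fin (n + 1)) :=
      fun n => barycenter (Fin (n + 1))
    let S : ∀ n : ℕ, ((Fin (k + 2) → stdSimplex ℝ (Fin (n + 1))) → ZMod 2) →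
      (Fin (k + 2) → stdSimplex ℝ (Fin (n + 1))) → ZMod 2 := fun n => tupleSubdiv (b n) (k + 1)
    have hvan : ∀ {n : ℕ} (σ : Simplex n X), ∃ m₀, ∀ m ≥ m₀, (S n)^[m] (tupleValue f σ) = 0 := by
      intro n σ
      obtain ⟨δ, hδ, h⟩ := exists_small_combo U hU hcov σ (k + 1)
      obtain ⟨m₀, hm₀⟩ := tupleSubdiv_iterate_eq_zero hδ (tupleValue f σ) fun q hq => by
        obtain ⟨i, hi⟩ := h q hq
        exact hsmall _ i hi
      exact ⟨m₀, fun m hm => funext (hm₀ m hm)⟩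
    choose m₀ hm₀ using fun τ : Simplex k X => hvan τ
    let t : ∀ {n : ℕ}, Simplex n X → ℕ → (Fin (k + 1) → stdSimplex ℝ (Fin (n + 1))) → ZMod 2 :=
      fun {n} τ l => tupleHomotopy (b n) k ((S n)^[l] (tupleValue f τ))
    -- The primitive sums the homotopies of the successive subdivisions of `f`. The number of terms
    -- depends on `τ`, but further terms vanish, so all faces of `σ` may be summed up to one common
    -- bound `m`.
    refine ⟨fun τ => ∑ l ∈ Finset.range (m₀ τ), t τ l fun i => stdSimplex.vertex i, ?_⟩
    funext σ
    obtain ⟨m₁, hm₁⟩ := hvan σ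
    set m := m₁ + ∑ i : Fin (k + 2), m₀ (σ.pull i.succAbove) with hm
    have hext : ∀ i : Fin (k + 2),
        ∑ l ∈ Finset.range (m₀ (σ.pull i.succAbove)),
          t (σ.pull i.succAbove) l (fun i => stdSimplex.vertex i) =
        ∑ l ∈ Finset.range m, t σ l ((fun i => stdSimplex.vertex i) ∘ i.succAbove) := by
      intro i
      have hle : m₀ (σ.pull i.succAbove) ≤ m :=
        (Finset.single_le_sum (f := fun i : Fin (k + 2) => m₀ (σ.pull i.succAbove))
          (fun _ _ => Nat.zero_le _) (Finset.mem_univ i)).trans (Nat.le_add_left _ _)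
      rw [Finset.sum_subset (Finset.range_mono hle)]
      · refine Finset.sum_congr rfl fun l _ => ?_
        have hS : ∀ l : ℕ, (S k)^[l] (tupleValue f (σ.pull i.succAbove)) =
            fun q => (S (k + 1))^[l] (tupleValue f σ) (stdSimplex.map i.succAbove ∘ q) := by
          intro l
          induction l with
          | zero =>
            funext q
            exact tupleValue_pull f σ i.succAbove q
          | succ l ih =>
            funext q
            rw [Function.iterate_succ_apply', ih, Function.iterate_succ_apply']
            exact tupleSubdiv_comp _ _ _ (fun k p => barycenter_map i.succAbove k p) _ _ _
        show tupleHomotopy _ _ _ _ = tupleHomotopy _ _ _ _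
        rw [hS]
        refine (tupleHomotopy_comp _ _ _ (fun k p => barycenter_map i.succAbove k p) _ _ _).trans ?_
        congr 1
        funext j
        exact stdSimplex.map_vertex _ _
      · intro l _ hl
        show tupleHomotopy _ _ _ _ = 0
        rw [hm₀ _ l (not_lt.1 (mt Finset.mem_range.2 hl)), tupleHomotopy_zero]
        rfl
    have hcob : ∀ l : ℕ, tupleCoboundary ((S (k + 1))^[l] (tupleValue f σ)) = 0 := by
      have h0 : tupleCoboundary (tupleValue f σ) = 0 := by
        rw [tupleCoboundary_tupleValue, show coboundary _ X f = 0 from hf]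
        rfl
      have hsub0 : ∀ j, tupleSubdiv (b (k + 1)) j 0 = 0 := fun j => by
        have h := tupleSubdiv_add (b (k + 1)) j 0 0
        rw [add_zero] at h
        exact left_eq_add.1 h
      intro l
      induction l with
      | zero => exact h0
      | succ l ih =>
        rw [Function.iterate_succ_apply', ← tupleSubdiv_tupleCoboundary, ih, hsub0]
    -- Since `f` is a cocycle, consecutive subdivisions differ by the coboundary of a homotopy term;
    -- the sum telescopes to `f` plus its `m`-th subdivision, which is zero.
    have hstep : ∀ l : ℕ, tupleCoboundary (t σ l) =
        (S (k + 1))^[l] (tupleValue f σ) + (S (k + 1))^[l + 1] (tupleValue f σ) := by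
      intro l
      have h := tupleHomotopy_tupleCoboundary (b (k + 1)) k ((S (k + 1))^[l] (tupleValue f σ))
      rw [hcob, tupleHomotopy_zero, zero_add] at h
      rw [Function.iterate_succ_apply']
      exact h
    show ∑ i : Fin (k + 2), ∑ l ∈ Finset.range (m₀ (σ.pull i.succAbove)),
      t (σ.pull i.succAbove) l (fun i => stdSimplex.vertex i) = f σ
    rw [Finset.sum_congr rfl fun i _ => hext i, Finset.sum_comm]
    have hl : ∀ l ∈ Finset.range m,
        ∑ i : Fin (k + 2), t σ l ((fun i => stdSimplex.vertex i) ∘ i.succAbove) =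
        (S (k + 1))^[l] (tupleValue f σ) (fun i => stdSimplex.vertex i) +
          (S (k + 1))^[l + 1] (tupleValue f σ) (fun i => stdSimplex.vertex i) :=
      fun l _ => congrFun (hstep l) fun i => stdSimplex.vertex i
    rw [Finset.sum_congr rfl hl, sum_range_telescope_charTwo
      fun l => (S (k + 1))^[l] (tupleValue f σ) fun i => stdSimplex.vertex i]
    rw [hm₁ m (Nat.le_add_right _ _), Pi.zero_apply, add_zero]
    exact tupleValue_vertex f σ

end Small

end SingularMod2

/-! ### Cup products of degree-one classes -/

namespace SingularMod2

section

variable {X Y : Type*} [TopologicalSpace X] [TopologicalSpace Y]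

theorem Cohomology.pullback_cup {p q r : ℕ} (h : p + q = r) (u : C(X, Y)) (a : Cohomology p Y)
    (b : Cohomology q Y) : Cohomology.pullback r u (Cohomology.cup h a b) =
      Cohomology.cup h (Cohomology.pullback p u a) (Cohomology.pullback q u b) := by
  induction a using Submodule.Quotient.induction_on
  induction b using Submodule.Quotient.induction_on
  rfl

theorem Cohomology.pullback_cupProd (u : C(X, Y)) (k : ℕ) (α : Fin k → Cohomology 1 Y) :
    Cohomology.pullback k u (Cohomology.cupProd k α) =
      Cohomology.cupProd k fun i => Cohomology.pullback 1 u (α i) := by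
  induction k with
  | zero => rfl
  | succ k ih =>
    rw [Cohomology.cupProd, Cohomology.pullback_cup, ih]
    rfl

/-- A product of cocycles of degree one represents the cup product, and vanishes on all simplices
in a set on which one of the factors vanishes. -/
theorem exists_cocycle_cupProd (k : ℕ) (f : Fin k → cocycles 1 X) :
    ∃ F : cocycles k X, Cohomology.cupProd k (fun i => classOf (f i)) = classOf F ∧
      ∀ (σ : Simplex k X) (U : Set X), (∀ x, σ x ∈ U) →
        (∃ i, ∀ γ : Simplex 1 X, (∀ x, γ x ∈ U) → (f i).1 γ = 0) → F.1 σ = 0 := by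
  induction k with
  | zero => exact ⟨_, rfl, fun _ _ _ ⟨i, _⟩ => i.elim0⟩
  | succ k ih =>
    obtain ⟨F, hF, hF0⟩ := ih (Fin.init f)
    refine ⟨⟨Cochain.cup rfl F.1 (f (Fin.last k)).1, Cochain.cup_mem_cocycles rfl F.2 (f _).2⟩,
      ?_, ?_⟩
    · show Cohomology.cup rfl (Cohomology.cupProd k fun i => classOf (Fin.init f i)) _ = _
      rw [hF]
      rfl
    · rintro σ U hσ ⟨i, hi⟩
      show F.1 (σ.pull _) * (f (Fin.last k)).1 (σ.pull _) = 0
      induction i using Fin.lastCases with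
      | last => rw [hi _ fun x => hσ _, mul_zero]
      | cast i => rw [hF0 _ U (fun x => hσ _) ⟨i, hi⟩, zero_mul]

end

end SingularMod2

namespace SimplicialSystole

open SingularMod2

variable {V : Type*} [Fintype V] [LinearOrder V]

/-! ### Affine simplices in the realization -/

theorem combo_mem_realization (M : PreAbstractSimplicialComplex V) {ι : Type*} [Fintype ι]
    {s : Finset V} (hs : s ∈ M.faces) {p : ι → stdSimplex ℝ V} (hp : ∀ i v, p i v ≠ 0 → v ∈ s)
    (w : stdSimplex ℝ ι) : (combo p w : V → ℝ) ∈ realization M := by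
  refine ⟨(combo p w).2, (M.isRelLowerSet_faces hs).2 ?_ ?_⟩
  · intro v hv
    by_contra hvs
    refine (Finset.mem_filter.1 hv).2 ((combo_apply p w v).trans ?_)
    refine Finset.sum_eq_zero fun i _ => ?_
    rw [not_not.1 (mt (hp i v) hvs), mul_zero]
  · by_contra hne
    rw [Finset.not_nonempty_iff_eq_empty, Finset.filter_eq_empty_iff] at hne
    have h1 := stdSimplex.sum_eq_one (combo p w)
    rw [Finset.sum_eq_zero fun v hv => not_not.1 (hne hv)] at h1
    exact zero_ne_one h1

/-- The affine simplex with prescribed vertices, as a singular simplex of the realization. -/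
def affineSimplex (M : PreAbstractSimplicialComplex V) {k : ℕ} (p : Fin (k + 1) → stdSimplex ℝ V)
    (h : ∀ w, (combo p w : V → ℝ) ∈ realization M) : Simplex k (realization M) where
  toFun w := ⟨combo p w, h w⟩
  continuous_toFun := Continuous.subtype_mk
    (continuous_subtype_val.comp (continuous_combo p)) _

theorem affineSimplex_pull (M : PreAbstractSimplicialComplex V) {k l : ℕ}
    (p : Fin (k + 1) → stdSimplex ℝ V) (h : ∀ w, (combo p w : V → ℝ) ∈ realization M)
    (φ : Fin (l + 1) → Fin (k + 1)) (q : Fin (l + 1) → stdSimplex ℝ V) (hq : p ∘ φ = q) :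
    (affineSimplex M p h).pull φ = affineSimplex M q fun w => by
      rw [← hq, ← combo_map]
      exact h _ := by
  subst hq
  refine ContinuousMap.ext fun w => Subtype.ext ?_
  exact congrArg (fun y : stdSimplex ℝ V => (y : V → ℝ)) (combo_map p φ w)

open Classical in
/-- The value of a cochain on the segment between two points (zero if the segment does not lie in
the realization). -/
def segValue {M : PreAbstractSimplicialComplex V} (f : Cochain 1 (realization M))
    (p q : stdSimplex ℝ V) : ZMod 2 :=
  if h : ∀ w, (combo ![p, q] w : V → ℝ) ∈ realization M then f (affineSimplex M ![p, q] h) else 0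

theorem segValue_eq {M : PreAbstractSimplicialComplex V} (f : Cochain 1 (realization M))
    (p q : stdSimplex ℝ V) (h : ∀ w, (combo ![p, q] w : V → ℝ) ∈ realization M) :
    segValue f p q = f (affineSimplex M ![p, q] h) := dif_pos h

/-- Points supported in one face span an affine triangle in the realization, and the cocycle
vanishes on its boundary. -/
theorem segValue_triangle {M : PreAbstractSimplicialComplex V} {f : Cochain 1 (realization M)}
    (hf : f ∈ cocycles 1 (realization M)) {s : Finset V} (hs : s ∈ M.faces)
    {p q r : stdSimplex ℝ V} (hp : ∀ v, p v ≠ 0 → v ∈ s) (hq : ∀ v, q v ≠ 0 → v ∈ s)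
    (hr : ∀ v, r v ≠ 0 → v ∈ s) : segValue f p q + segValue f q r = segValue f p r := by
  have h3 : ∀ w, (combo ![p, q, r] w : V → ℝ) ∈ realization M :=
    combo_mem_realization M hs (Fin.forall_fin_succ.2 ⟨hp, Fin.forall_fin_two.2 ⟨hq, hr⟩⟩)
  have h2 : ∀ {a b : stdSimplex ℝ V}, (∀ v, a v ≠ 0 → v ∈ s) → (∀ v, b v ≠ 0 → v ∈ s) →
      ∀ w, (combo ![a, b] w : V → ℝ) ∈ realization M := fun ha hb =>
    combo_mem_realization M hs (Fin.forall_fin_two.2 ⟨ha, hb⟩)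
  rw [segValue_eq f p q (h2 hp hq), segValue_eq f q r (h2 hq hr), segValue_eq f p r (h2 hp hr)]
  have h := congrFun (show coboundary 1 _ f = 0 from hf) (affineSimplex M ![p, q, r] h3)
  have h' : ∑ i : Fin 3, f ((affineSimplex M ![p, q, r] h3).pull i.succAbove) = 0 := h
  rw [Fin.sum_univ_three,
    affineSimplex_pull M _ h3 (Fin.succAbove 0) ![q, r] (by funext i; fin_cases i <;> rfl),
    affineSimplex_pull M _ h3 (Fin.succAbove 1) ![p, r] (by funext i; fin_cases i <;> rfl),
    affineSimplex_pull M _ h3 (Fin.succAbove 2) ![p, q] (by funext i; fin_cases i <;> rfl)] at h'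
  have key : ∀ a b c : ZMod 2, a + b + c = 0 → c + a = b := by decide
  exact key _ _ _ h'

theorem segValue_self {M : PreAbstractSimplicialComplex V} {f : Cochain 1 (realization M)}
    (hf : f ∈ cocycles 1 (realization M)) {s : Finset V} (hs : s ∈ M.faces)
    {p : stdSimplex ℝ V} (hp : ∀ v, p v ≠ 0 → v ∈ s) : segValue f p p = 0 :=
  left_eq_add.1 (segValue_triangle hf hs hp hp hp).symm

theorem segValue_comm {M : PreAbstractSimplicialComplex V} {f : Cochain 1 (realization M)}
    (hf : f ∈ cocycles 1 (realization M)) {s : Finset V} (hs : s ∈ M.faces)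
    {p q : stdSimplex ℝ V} (hp : ∀ v, p v ≠ 0 → v ∈ s) (hq : ∀ v, q v ≠ 0 → v ∈ s) :
    segValue f p q = segValue f q p := by
  have h := segValue_triangle hf hs hp hq hp
  rw [segValue_self hf hs hp] at h
  exact CharTwo.add_eq_zero.1 h

theorem vertex_ne_zero {v w : V} (h : (stdSimplex.vertex v : stdSimplex ℝ V) w ≠ 0) : w = v := by
  by_contra hvw
  exact h (by simp [hvw])

/-! ### Cones over paths in open stars -/

/-- The point of the standard simplex underlying a point of the realization. -/
def toStd {M : PreAbstractSimplicialComplex V} (x : realization M) : stdSimplex ℝ V :=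
  ⟨x.1, x.2.1⟩

theorem cone_mem {M : PreAbstractSimplicialComplex V} (v : V) (x : realization M)
    (hv : x.1 v ≠ 0) (w : stdSimplex ℝ (Fin 2)) :
    (combo ![stdSimplex.vertex v, toStd x] w : V → ℝ) ∈ realization M := by
  refine combo_mem_realization M x.2.2 (Fin.forall_fin_two.2 ⟨fun u hu => ?_, fun u hu => ?_⟩) w
  · rw [vertex_ne_zero hu]
    exact Finset.mem_filter.2 ⟨Finset.mem_univ _, hv⟩
  · exact Finset.mem_filter.2 ⟨Finset.mem_univ _, hu⟩

/-- A simplex in the square swept out by the segments from `v` to the points of the path `γ`. -/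
def coneSimplex {M : PreAbstractSimplicialComplex V} (v : V) (γ : Simplex 1 (realization M))
    (hγ : ∀ t, (γ t).1 v ≠ 0) {k : ℕ} (φ ψ : Fin (k + 1) → Fin 2) :
    Simplex k (realization M) where
  toFun w := ⟨combo ![stdSimplex.vertex v, toStd (γ (stdSimplex.map φ w))] (stdSimplex.map ψ w),
    cone_mem v _ (hγ _) _⟩
  continuous_toFun := by
    refine Continuous.subtype_mk (continuous_pi fun u => ?_) _
    simp only [combo_apply, Fin.sum_univ_two]
    have h1 : ∀ i, Continuous fun w : stdSimplex ℝ (Fin (k + 1)) => stdSimplex.map ψ w i :=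
      fun i => (continuous_apply i).comp
        (continuous_subtype_val.comp (stdSimplex.continuous_map ψ))
    have h2 : Continuous fun w : stdSimplex ℝ (Fin (k + 1)) => (γ (stdSimplex.map φ w)).1 u :=
      (continuous_apply u).comp (continuous_subtype_val.comp
        (γ.continuous.comp (stdSimplex.continuous_map φ)))
    exact ((h1 0).mul continuous_const).add ((h1 1).mul h2)

theorem coneSimplex_pull {M : PreAbstractSimplicialComplex V} (v : V)
    (γ : Simplex 1 (realization M)) (hγ : ∀ t, (γ t).1 v ≠ 0) {k l : ℕ}
    (φ ψ : Fin (k + 1) → Fin 2) (θ : Fin (l + 1) → Fin (k + 1)) (φ' ψ' : Fin (l + 1) → Fin 2)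
    (hφ : φ ∘ θ = φ') (hψ : ψ ∘ θ = ψ') :
    (coneSimplex v γ hγ φ ψ).pull θ = coneSimplex v γ hγ φ' ψ' := by
  subst hφ hψ
  refine ContinuousMap.ext fun w => Subtype.ext ?_
  show (combo ![_, toStd (γ (stdSimplex.map φ (stdSimplex.map θ w)))]
    (stdSimplex.map ψ (stdSimplex.map θ w)) : V → ℝ) = _
  rw [stdSimplex.map_comp_apply, stdSimplex.map_comp_apply]
  rfl

theorem stdSimplex_map_const {k n : ℕ} (w : stdSimplex ℝ (Fin (k + 1))) (j : Fin (n + 1)) :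
    stdSimplex.map (fun _ => j) w = (stdSimplex.vertex j : stdSimplex ℝ (Fin (n + 1))) := by
  have hw : ∑ i, w i = 1 := w.2.2
  rw [← combo_vertex_comp]
  ext v
  rw [combo_apply, ← Finset.sum_mul, hw, one_mul]

/-- The path is homotoped to the cone point: the square of segments from `v` to `γ` is cut along its
diagonal into two triangles, and the cocycle condition is added over both. -/
theorem apply_eq_segValue_add_segValue {M : PreAbstractSimplicialComplex V}
    {f : Cochain 1 (realization M)} (hf : f ∈ cocycles 1 (realization M)) (v : V)
    (γ : Simplex 1 (realization M)) (hγ : ∀ t, (γ t).1 v ≠ 0) :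
    f γ = segValue f (stdSimplex.vertex v) (toStd (γ (stdSimplex.vertex 0))) +
      segValue f (stdSimplex.vertex v) (toStd (γ (stdSimplex.vertex 1))) := by
  have hcob : ∀ φ ψ : Fin 3 → Fin 2,
      ∑ i : Fin 3, f (coneSimplex v γ hγ (φ ∘ i.succAbove) (ψ ∘ i.succAbove)) = 0 := by
    intro φ ψ
    have h := congrFun (show coboundary 1 _ f = 0 from hf) (coneSimplex v γ hγ φ ψ)
    refine Eq.trans (Finset.sum_congr rfl fun i _ => ?_)
      (show ∑ i : Fin 3, f ((coneSimplex v γ hγ φ ψ).pull i.succAbove) = 0 from h)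
    rw [coneSimplex_pull v γ hγ φ ψ i.succAbove _ _ rfl rfl]
  have hconst : ∀ φ : Fin 2 → Fin 2, coneSimplex v γ hγ φ (fun _ => 0) =
      coneSimplex v γ hγ (fun _ => 0) fun _ => 0 := by
    intro φ
    refine ContinuousMap.ext fun w => Subtype.ext ?_
    show (combo _ (stdSimplex.map (fun _ => (0 : Fin 2)) w) : V → ℝ) =
      combo _ (stdSimplex.map (fun _ => (0 : Fin 2)) w)
    rw [stdSimplex_map_const, combo_vertex, combo_vertex]
    rfl
  have hseg : ∀ j : Fin 2, f (coneSimplex v γ hγ (fun _ => j) id) =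
      segValue f (stdSimplex.vertex v) (toStd (γ (stdSimplex.vertex j))) := by
    intro j
    rw [segValue_eq f _ _ (cone_mem v _ (hγ _))]
    refine congrArg f (ContinuousMap.ext fun w => Subtype.ext ?_)
    show (combo ![_, toStd (γ (stdSimplex.map (fun _ => j) w))] (stdSimplex.map id w) : V → ℝ) = _
    rw [stdSimplex_map_const, stdSimplex.map_id_apply]
    rfl
  have hpath : coneSimplex v γ hγ id (fun _ => 1) = γ := by
    refine ContinuousMap.ext fun w => Subtype.ext ?_
    show (combo ![_, toStd (γ (stdSimplex.map id w))] (stdSimplex.map (fun _ => 1) w) : V → ℝ) = _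
    rw [stdSimplex_map_const, combo_vertex, stdSimplex.map_id_apply]
    rfl
  -- `h0` says that the constant path at `v` has value zero. In `h1` and `h2`, the first index
  -- vector is the parameter along the path and the second the distance from `v`; the shared
  -- diagonal cancels.
  have h0 := hcob (fun _ => 0) fun _ => 0
  have h1 := hcob ![0, 1, 1] ![0, 0, 1]
  have h2 := hcob ![0, 0, 1] ![0, 1, 1]
  rw [Fin.sum_univ_three] at h0 h1 h2
  have e1 : (![0, 1, 1] : Fin 3 → Fin 2) ∘ Fin.succAbove 0 = fun _ => 1 := by decide
  have e2 : (![0, 0, 1] : Fin 3 → Fin 2) ∘ Fin.succAbove 0 = id := by decide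
  have e3 : (![0, 1, 1] : Fin 3 → Fin 2) ∘ Fin.succAbove 1 = id := by decide
  have e4 : (![0, 0, 1] : Fin 3 → Fin 2) ∘ Fin.succAbove 1 = id := by decide
  have e5 : (![0, 1, 1] : Fin 3 → Fin 2) ∘ Fin.succAbove 2 = id := by decide
  have e6 : (![0, 0, 1] : Fin 3 → Fin 2) ∘ Fin.succAbove 2 = fun _ => 0 := by decide
  rw [e1, e2, e3, e4, e5, e6] at h1 h2
  have h0' : f (coneSimplex v γ hγ (fun _ : Fin 2 => 0) fun _ => 0) +
    f (coneSimplex v γ hγ (fun _ : Fin 2 => 0) fun _ => 0) +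
    f (coneSimplex v γ hγ (fun _ : Fin 2 => 0) fun _ => 0) = 0 := h0
  rw [hconst, hseg] at h1
  rw [hpath, hseg] at h2
  have key : ∀ a b c d e : ZMod 2, a + a + a = 0 → d + c + a = 0 → b + c + e = 0 →
      b = e + d := by decide
  exact key _ _ _ _ _ h0' h1 h2

/-! ### Potentials -/

/-- The cocycle `f` has a primitive on the union of the open barycentric stars of the faces in
`P`, expressed through its values on segments between vertices. -/
def HasPotential {M : PreAbstractSimplicialComplex V} (f : Cochain 1 (realization M))
    (P : Set (Finset V)) : Prop :=
  ∃ ψ : Finset V → V → ZMod 2,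
    (∀ s ∈ P, ∀ v ∈ s, ∀ w ∈ s,
      ψ s v + ψ s w = segValue f (stdSimplex.vertex v) (stdSimplex.vertex w)) ∧
    ∀ s ∈ P, ∀ t ∈ P, s ⊆ t → ∀ v ∈ s, ψ s v = ψ t v

/-- The open star of the barycentre of `s` in the barycentric subdivision. -/
def barycentricStar (s : Finset V) : Set (V → ℝ) :=
  {x | (∀ v ∈ s, 0 < x v) ∧ ∀ v ∈ s, ∀ w ∉ s, x w < x v}

theorem isOpen_barycentricStar (s : Finset V) : IsOpen (barycentricStar s) := by
  have h : barycentricStar s =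
      (⋂ v ∈ s, {x | 0 < x v}) ∩ ⋂ v ∈ s, ⋂ w ∈ sᶜ, {x | x w < x v} := by
    ext x
    simp [barycentricStar]
  rw [h]
  refine IsOpen.inter (isOpen_biInter_finset fun v _ => ?_)
    (isOpen_biInter_finset fun v _ => isOpen_biInter_finset fun w _ => ?_)
  · exact isOpen_lt continuous_const (continuous_apply v)
  · exact isOpen_lt (continuous_apply w) (continuous_apply v)

/-- Each of the two faces consists of coordinates larger than all others at the point, so the faces
form a chain. -/
theorem subset_or_subset_of_mem_barycentricStar {s t : Finset V} {x : V → ℝ}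
    (hs : x ∈ barycentricStar s) (ht : x ∈ barycentricStar t) : s ⊆ t ∨ t ⊆ s := by
  by_contra! h
  obtain ⟨v, hv, hvt⟩ := Finset.not_subset.1 h.1
  obtain ⟨w, hw, hws⟩ := Finset.not_subset.1 h.2
  exact lt_asymm (hs.2 v hv w hws) (ht.2 w hw v hvt)

theorem mem_barycentricStar_support {M : PreAbstractSimplicialComplex V} {x : V → ℝ}
    (hx : x ∈ realization M) :
    x ∈ barycentricStar (Finset.univ.filter fun v => x v ≠ 0) := by
  have hpos : ∀ v ∈ Finset.univ.filter (fun v => x v ≠ 0), 0 < x v := fun v hv =>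
    lt_of_le_of_ne (hx.1.1 v) (Finset.mem_filter.1 hv).2.symm
  refine ⟨hpos, fun v hv w hw => ?_⟩
  have : x w = 0 := by simpa using hw
  rw [this]
  exact hpos v hv

/-- On the star of `s` the primitive is the potential at a vertex `v` of `s` plus the value of `f`
on the segment from `v` to the point. Changing `v` or `s` is harmless: overlapping stars come from
nested faces, and both vertices and the point lie in one face of `M`. -/
theorem exists_primitive {M : PreAbstractSimplicialComplex V} {f : Cochain 1 (realization M)}
    (hf : f ∈ cocycles 1 (realization M)) {P : Set (Finset V)} (hP : HasPotential f P) :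
    ∃ g : realization M → ZMod 2, ∀ s ∈ P, s.Nonempty → ∀ γ : Simplex 1 (realization M),
      (∀ t, (γ t).1 ∈ barycentricStar s) →
        f γ = g (γ (stdSimplex.vertex 0)) + g (γ (stdSimplex.vertex 1)) := by
  classical
  obtain ⟨ψ, hψ, hψ'⟩ := hP
  have hsub : ∀ (x : realization M) (s t : Finset V) (v w : V), s ∈ P → t ∈ P → v ∈ s → w ∈ t →
      x.1 ∈ barycentricStar s → x.1 ∈ barycentricStar t → s ⊆ t →
      ψ s v + segValue f (stdSimplex.vertex v) (toStd x) =
        ψ t w + segValue f (stdSimplex.vertex w) (toStd x) := by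
    intro x s t v w hs ht hv hw hxs hxt hst
    have hmem : ∀ u, x.1 u ≠ 0 → u ∈ Finset.univ.filter (fun v => x.1 v ≠ 0) := fun u hu =>
      Finset.mem_filter.2 ⟨Finset.mem_univ _, hu⟩
    have h1 := segValue_triangle hf x.2.2
      (p := stdSimplex.vertex v) (q := stdSimplex.vertex w) (r := toStd x)
      (fun u hu => by
        rw [vertex_ne_zero hu]
        exact hmem _ (hxs.1 v hv).ne')
      (fun u hu => by
        rw [vertex_ne_zero hu]
        exact hmem _ (hxt.1 w hw).ne')
      hmem
    rw [hψ' s hs t ht hst v hv, ← h1, ← hψ t ht v (hst hv) w hw]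
    have key : ∀ a b c : ZMod 2, a + (a + b + c) = b + c := by decide
    exact key _ _ _
  have hwd : ∀ (x : realization M) (s t : Finset V) (v w : V), s ∈ P → t ∈ P → v ∈ s → w ∈ t →
      x.1 ∈ barycentricStar s → x.1 ∈ barycentricStar t →
      ψ s v + segValue f (stdSimplex.vertex v) (toStd x) =
        ψ t w + segValue f (stdSimplex.vertex w) (toStd x) := by
    intro x s t v w hs ht hv hw hxs hxt
    rcases subset_or_subset_of_mem_barycentricStar hxs hxt with h | h
    · exact hsub x s t v w hs ht hv hw hxs hxt h
    · exact (hsub x t s w v ht hs hw hv hxt hxs h).symm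
  let g : realization M → ZMod 2 := fun x =>
    if h : ∃ y : Finset V × V, y.1 ∈ P ∧ y.2 ∈ y.1 ∧ x.1 ∈ barycentricStar y.1 then
      ψ h.choose.1 h.choose.2 + segValue f (stdSimplex.vertex h.choose.2) (toStd x) else 0
  have hg : ∀ (x : realization M) (s : Finset V) (v : V), s ∈ P → v ∈ s →
      x.1 ∈ barycentricStar s →
      g x = ψ s v + segValue f (stdSimplex.vertex v) (toStd x) := by
    intro x s v hs hv hx
    have h : ∃ y : Finset V × V, y.1 ∈ P ∧ y.2 ∈ y.1 ∧ x.1 ∈ barycentricStar y.1 :=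
      ⟨(s, v), hs, hv, hx⟩
    simp only [g]
    rw [dif_pos h]
    exact hwd x _ _ _ _ h.choose_spec.1 hs h.choose_spec.2.1 hv h.choose_spec.2.2 hx
  refine ⟨g, fun s hs ⟨v, hv⟩ γ hγ => ?_⟩
  rw [hg _ s v hs hv (hγ _), hg _ s v hs hv (hγ _),
    apply_eq_segValue_add_segValue hf v γ fun t => ((hγ t).1 v hv).ne']
  have key : ∀ a b c : ZMod 2, a + b = (c + a) + (c + b) := by decide
  exact key _ _ _

theorem exists_cocycle_eq_zero_on_star {M : PreAbstractSimplicialComplex V}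
    (f : cocycles 1 (realization M)) {P : Set (Finset V)} (hP : HasPotential f.1 P)
    (hne : ∀ s ∈ P, s.Nonempty) {S : Set (V → ℝ)} (hS : S ⊆ realization M) :
    ∃ f' : cocycles 1 S,
      Cohomology.pullback 1 (ContinuousMap.inclusion hS) (classOf f) = classOf f' ∧
      ∀ s ∈ P, ∀ γ : Simplex 1 S, (∀ t, (γ t).1 ∈ barycentricStar s) → f'.1 γ = 0 := by
  obtain ⟨g, hg⟩ := exists_primitive f.2 hP
  let u := ContinuousMap.inclusion hS
  -- No continuity of `g` is needed, as singular 0-cochains are arbitrary functions on points.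
  let G : Cochain 0 S := fun τ => g (u (τ (stdSimplex.vertex 0)))
  have hG : coboundary 0 S G ∈ cocycles 1 S := by
    show coboundary 1 S (coboundary 0 S G) = 0
    funext σ
    show ∑ i : Fin 3, ∑ j : Fin 2, G ((σ.pull i.succAbove).pull j.succAbove) = 0
    simp only [Fin.sum_univ_three, Fin.sum_univ_two, Simplex.pull_pull, G]
    have e : ∀ φ : Fin 1 → Fin 3, (σ.pull φ) (stdSimplex.vertex 0) =
        σ (stdSimplex.vertex (φ 0)) := fun φ => congrArg σ (stdSimplex.map_vertex φ 0)
    simp only [e, Function.comp_apply]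
    have key : ∀ a b c : ZMod 2, (c + b) + (c + a) + (b + a) = 0 := by decide
    exact key (g (u (σ (stdSimplex.vertex 0)))) (g (u (σ (stdSimplex.vertex 1))))
      (g (u (σ (stdSimplex.vertex 2))))
  refine ⟨⟨Cochain.pullback 1 u f.1 - coboundary 0 S G, Submodule.sub_mem _
    (Cochain.pullback_mem_cocycles u f.1 f.2) hG⟩, ?_, ?_⟩
  · refine (Submodule.Quotient.eq _).2 ?_
    show Cochain.pullback 1 u f.1 - (Cochain.pullback 1 u f.1 - coboundary 0 S G) ∈
      coboundaries 1 S
    rw [sub_sub_cancel]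
    exact ⟨G, rfl⟩
  · intro s hs γ hγ
    show f.1 (u.comp γ) - ∑ i : Fin 2, G (γ.pull i.succAbove) = 0
    rw [hg s hs (hne s hs) (u.comp γ) hγ, Fin.sum_univ_two]
    have e : ∀ φ : Fin 1 → Fin 2, (γ.pull φ) (stdSimplex.vertex 0) =
        γ (stdSimplex.vertex (φ 0)) := fun φ => congrArg γ (stdSimplex.map_vertex φ 0)
    simp only [G, e]
    have key : ∀ a b : ZMod 2, a + b - (b + a) = 0 := by decide
    exact key _ _

/-- If every face outside `H` belongs to a family on which one of the factors has a potential,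
then `H` cuts the cup product. -/
theorem cuts_cupProd {M H : PreAbstractSimplicialComplex V} {k : ℕ}
    (f : Fin k → cocycles 1 (realization M)) (P : Fin k → Set (Finset V))
    (hPM : ∀ i, P i ⊆ M.faces) (hP : ∀ i, HasPotential (f i).1 (P i))
    (hcov : ∀ s ∈ M.faces, s ∉ H.faces → ∃ i, s ∈ P i) :
    Cuts M H (Cohomology.cupProd k fun i => classOf (f i)) := by
  have hS : realization M \ realization H ⊆ realization M := Set.sdiff_subset
  choose f' hf' hf0 using fun i => exists_cocycle_eq_zero_on_star (f i) (hP i)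
    (fun s hs => (M.isRelLowerSet_faces (hPM i hs)).1) hS
  obtain ⟨F, hF, hF0⟩ := exists_cocycle_cupProd k f'
  show Cohomology.pullback k (ContinuousMap.inclusion hS) _ = 0
  rw [Cohomology.pullback_cupProd]
  simp only [hf']
  rw [hF]
  refine (Submodule.Quotient.mk_eq_zero _).2 ?_
  let U : {s : Finset V // ∃ i, s ∈ P i} → Set ↥(realization M \ realization H) :=
    fun s => Subtype.val ⁻¹' barycentricStar s.1
  refine mem_coboundaries_of_small U
    (fun s => (isOpen_barycentricStar s.1).preimage continuous_subtype_val) ?_ F.1 F.2 ?_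
  · intro x
    have hx := x.2
    -- A point lies in the star of its own support, which is not a face of `H` because the point is
    -- outside `H`.
    refine ⟨⟨_, hcov _ hx.1.2 fun h => hx.2 ⟨hx.1.1, h⟩⟩, ?_⟩
    exact mem_barycentricStar_support hx.1
  · rintro σ ⟨s, i, hi⟩ hσ
    exact hF0 σ _ hσ ⟨i, fun γ hγ => hf0 i s hi γ hγ⟩

end SimplicialSystole

namespace SimplicialSystole

open SingularMod2

variable {V : Type*} [Fintype V] [LinearOrder V]

/-! ### Chains of edges between two vertices -/

theorem sum_symmDiff_charTwo {ι : Type*} [DecidableEq ι] (s t : Finset ι) (h : ι → ZMod 2) :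
    ∑ i ∈ symmDiff s t, h i = ∑ i ∈ s, h i + ∑ i ∈ t, h i := by
  rw [symmDiff, Finset.sup_eq_union, Finset.sum_union disjoint_sdiff_sdiff,
    ← Finset.sum_inter_add_sum_sdiff s t, ← Finset.sum_inter_add_sum_sdiff t s,
    Finset.inter_comm t s]
  have key : ∀ a b c : ZMod 2, a + b = c + a + (c + b) := by decide
  exact key _ _ _

/-- There is a chain of at most `l` edges with boundary `u + v` on which `f` has the value `x`. -/
def Joined {M : PreAbstractSimplicialComplex V} (f : Cochain 1 (realization M)) (l : ℕ) (u v : V)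
    (x : ZMod 2) : Prop :=
  ∃ z : Finset (simplices M 1), z.card ≤ l ∧
    (∀ w : V, ∑ s ∈ z, (if w ∈ s.1 then (1 : ZMod 2) else 0) =
      (if w = u then 1 else 0) + if w = v then 1 else 0) ∧ evalChain z f = x

theorem Joined.mono {M : PreAbstractSimplicialComplex V} {f : Cochain 1 (realization M)}
    {l l' : ℕ} {u v : V} {x : ZMod 2} (h : Joined f l u v x) (hl : l ≤ l') : Joined f l' u v x := by
  obtain ⟨z, hz, h'⟩ := h
  exact ⟨z, hz.trans hl, h'⟩

theorem Joined.symm {M : PreAbstractSimplicialComplex V} {f : Cochain 1 (realization M)}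
    {l : ℕ} {u v : V} {x : ZMod 2} (h : Joined f l u v x) : Joined f l v u x := by
  obtain ⟨z, hz, h1, h2⟩ := h
  exact ⟨z, hz, fun w => (h1 w).trans (add_comm _ _), h2⟩

theorem Joined.trans {M : PreAbstractSimplicialComplex V} {f : Cochain 1 (realization M)}
    {l l' : ℕ} {u v w : V} {x y : ZMod 2} (h : Joined f l u v x) (h' : Joined f l' v w y) :
    Joined f (l + l') u w (x + y) := by
  obtain ⟨z, hz, h1, h2⟩ := h
  obtain ⟨z', hz', h1', h2'⟩ := h'
  refine ⟨symmDiff z z', ?_, fun t => ?_, ?_⟩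
  · refine (Finset.card_union_le _ _).trans (add_le_add ?_ ?_)
    · exact (Finset.card_le_card Finset.sdiff_subset).trans hz
    · exact (Finset.card_le_card Finset.sdiff_subset).trans hz'
  · rw [sum_symmDiff_charTwo, h1, h1']
    have key : ∀ a b c : ZMod 2, a + b + (b + c) = a + c := by decide
    exact key _ _ _
  · rw [← h2, ← h2']
    exact sum_symmDiff_charTwo z z' fun s => f (toSingular M s)

theorem joined_self {M : PreAbstractSimplicialComplex V} (f : Cochain 1 (realization M)) (u : V) :
    Joined f 0 u u 0 := by
  refine ⟨∅, le_rfl, fun w => ?_, rfl⟩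
  rw [CharTwo.add_self_eq_zero]
  rfl

theorem vertex_support {s : Finset V} {v : V} (hv : v ∈ s) :
    ∀ w, (stdSimplex.vertex v : stdSimplex ℝ V) w ≠ 0 → w ∈ s := fun w hw => by
  rwa [vertex_ne_zero hw]

/-- `toSingular` orients an edge by the order of `V`; the opposite orientation is recovered in
`joined_edge` from `segValue_comm`. -/
theorem joined_of_lt {M : PreAbstractSimplicialComplex V} (f : Cochain 1 (realization M))
    {s : Finset V} (hs : s ∈ M.faces) {u v : V} (hu : u ∈ s) (hv : v ∈ s) (huv : u < v) :
    Joined f 1 u v (segValue f (stdSimplex.vertex u) (stdSimplex.vertex v)) := by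
  have he : ({u, v} : Finset V) ∈ simplices M 1 :=
    ⟨(M.isRelLowerSet_faces hs).2 (Finset.insert_subset hu (Finset.singleton_subset_iff.2 hv))
      ⟨u, Finset.mem_insert_self _ _⟩, Finset.card_pair huv.ne⟩
  refine ⟨{⟨_, he⟩}, le_rfl, fun w => ?_, ?_⟩
  · rw [Finset.sum_singleton]
    by_cases h1 : w = u
    · subst h1
      simp [huv.ne]
    · by_cases h2 : w = v <;> simp [h1, h2, huv.ne']
  · show ∑ t ∈ {(⟨_, he⟩ : simplices M 1)}, f (toSingular M t) = _
    have hemb : (![u, v] : Fin 2 → V) = Finset.orderEmbOfFin {u, v} he.2 := by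
      refine Finset.orderEmbOfFin_unique he.2 (Fin.forall_fin_two.2 ⟨?_, ?_⟩) ?_
      · exact Finset.mem_insert_self _ _
      · exact Finset.mem_insert_of_mem (Finset.mem_singleton_self _)
      · refine Fin.strictMono_iff_lt_succ.2 fun i => ?_
        obtain rfl : i = 0 := Fin.fin_one_eq_zero i
        exact huv
    rw [Finset.sum_singleton, segValue_eq f _ _ (combo_mem_realization M hs
      (Fin.forall_fin_two.2 ⟨vertex_support hu, vertex_support hv⟩))]
    refine congrArg f (ContinuousMap.ext fun w => Subtype.ext ?_)
    show (stdSimplex.map (Finset.orderEmbOfFin {u, v} he.2) w : V → ℝ) = combo _ w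
    rw [← combo_vertex_comp, ← hemb]
    congr 2
    funext i
    fin_cases i <;> rfl

theorem joined_edge {M : PreAbstractSimplicialComplex V} {f : Cochain 1 (realization M)}
    (hf : f ∈ cocycles 1 (realization M)) {s : Finset V} (hs : s ∈ M.faces) {u v : V}
    (hu : u ∈ s) (hv : v ∈ s) :
    Joined f 1 u v (segValue f (stdSimplex.vertex u) (stdSimplex.vertex v)) := by
  rcases lt_trichotomy u v with h | h | h
  · exact joined_of_lt f hs hu hv h
  · subst h
    rw [segValue_self hf hs (vertex_support hu)]
    exact (joined_self f u).mono zero_le_one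
  · rw [segValue_comm hf hs (vertex_support hu) (vertex_support hv)]
    exact (joined_of_lt f hs hv hu h).symm

/-- A chain with boundary `u + u = 0` is a cycle, hence a competitor for the systole. -/
theorem Joined.sys_le {M : PreAbstractSimplicialComplex V} (f : cocycles 1 (realization M))
    {l : ℕ} {u : V} {x : ZMod 2} (h : Joined f.1 l u u x) (hx : x ≠ 0) :
    sys M (classOf f) ≤ l := by
  obtain ⟨z, hz, h1, h2⟩ := h
  have hc : IsCycle z := by
    intro t _ ht
    obtain ⟨w, rfl⟩ := Finset.card_eq_one.1 ht
    have h := h1 w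
    rw [CharTwo.add_self_eq_zero, Finset.sum_boole] at h
    simpa only [Finset.singleton_subset_iff] using (ZMod.natCast_eq_zero_iff_even).1 h
  have hp : pairing z hc (classOf f) ≠ 0 := by
    show evalChain z f.1 ≠ 0
    rwa [h2]
  exact (iInf_le_of_le z (iInf_le_of_le hc (iInf_le _ hp))).trans (by exact_mod_cast hz)

/-! ### Region growing -/

/-- A monotone quantity below `2 ^ L` has a slow step among its first `L * q` steps. -/
theorem exists_slow_step {q L d : ℕ} (hq : 0 < q) (A D : ℕ → ℕ) (hA0 : 0 < A 0)
    (hAL : A (L * q) < 2 ^ L) (hA : Monotone A) (hD : ∀ r, D r + d * A r ≤ d * A (r + 1)) :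
    ∃ r ≤ L * q, q * D r ≤ d * A r := by
  -- Divide the `L * q` steps into `L` blocks of length `q`; if `A` doubled over each block it would
  -- reach `2 ^ L`.
  obtain ⟨j, hj, hj2⟩ : ∃ j < L, A ((j + 1) * q) < 2 * A (j * q) := by
    by_contra! h
    have hpow : ∀ j ≤ L, 2 ^ j ≤ A (j * q) := by
      intro j
      induction j with
      | zero =>
        intro _
        rw [zero_mul, pow_zero]
        exact hA0
      | succ j ih =>
        intro hj
        rw [pow_succ, mul_comm]
        exact (Nat.mul_le_mul_left 2 (ih (by omega))).trans (h j (by omega))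
    exact absurd (hpow L le_rfl) (not_le.2 hAL)
  by_contra! h
  have hle : ∀ i ≤ q, j * q + i ≤ L * q := fun i hi => by
    have : (j + 1) * q ≤ L * q := Nat.mul_le_mul_right q hj
    nlinarith
  -- If every step of block `j` were fast, each would contribute more than `d * A (j * q)` to `q`
  -- times the growth of `d * A`, which contradicts the absence of doubling.
  have hsum : ∀ i ≤ q, i * (d * A (j * q)) + i ≤ q * (d * A (j * q + i) - d * A (j * q)) := by
    intro i
    induction i with
    | zero => simp
    | succ i ih =>
      intro hi
      have h1 := ih (by omega)
      have h2 := h (j * q + i) (hle i (by omega))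
      have h3 := hD (j * q + i)
      have h4 : d * A (j * q) ≤ d * A (j * q + i) := Nat.mul_le_mul_left d (hA (by omega))
      have h5 : q * (d * A (j * q + i) - d * A (j * q)) + q * D (j * q + i) ≤
          q * (d * A (j * q + (i + 1)) - d * A (j * q)) := by
        rw [← mul_add, ← add_assoc (j * q)]
        exact Nat.mul_le_mul_left q (by omega)
      rw [add_mul]
      omega
  have h1 := hsum q le_rfl
  have h2 : j * q + q = (j + 1) * q := by ring
  have h3 : d * A ((j + 1) * q) - d * A (j * q) ≤ d * A (j * q) := by
    have : d * A ((j + 1) * q) ≤ d * (2 * A (j * q)) := Nat.mul_le_mul_left d hj2.le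
    have e : d * (2 * A (j * q)) = d * A (j * q) + d * A (j * q) := by ring
    omega
  rw [h2] at h1
  have h4 := Nat.mul_le_mul_left q h3
  omega

/-- The ball of radius `r` in the family `S`, where two members are adjacent if they contain a
common member of `B`. -/
def growBall (S B : Finset (Finset V)) (a₀ : Finset V) : ℕ → Finset (Finset V)
  | 0 => {a₀}
  | r + 1 => growBall S B a₀ r ∪
      S.filter fun a => ∃ a' ∈ growBall S B a₀ r, ∃ b ∈ B, b ⊆ a ∧ b ⊆ a'

/-- The members of `B` that separate `T` from the rest of `S`. -/
def interface (S B T : Finset (Finset V)) : Finset (Finset V) :=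
  B.filter fun b => (∃ a ∈ T, b ⊆ a) ∧ ∃ a ∈ S \ T, b ⊆ a

theorem growBall_subset {S B : Finset (Finset V)} {a₀ : Finset V} (h : a₀ ∈ S) (r : ℕ) :
    growBall S B a₀ r ⊆ S := by
  induction r with
  | zero => exact Finset.singleton_subset_iff.2 h
  | succ r ih => exact Finset.union_subset ih (Finset.filter_subset _ _)

theorem growBall_mono (S B : Finset (Finset V)) (a₀ : Finset V) : Monotone (growBall S B a₀) :=
  monotone_nat_of_le_succ fun _ => Finset.subset_union_left

theorem card_filter_exists_subset_le {S B T : Finset (Finset V)} {d : ℕ} (hT : T ⊆ S)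
    (hd : ∀ a ∈ S, (B.filter (· ⊆ a)).card ≤ d) :
    (B.filter fun b => ∃ a ∈ T, b ⊆ a).card ≤ d * T.card := by
  have h : (B.filter fun b => ∃ a ∈ T, b ⊆ a) ⊆ T.biUnion fun a => B.filter (· ⊆ a) := by
    intro b hb
    obtain ⟨hb, a, ha, hba⟩ := Finset.mem_filter.1 hb
    exact Finset.mem_biUnion.2 ⟨a, ha, Finset.mem_filter.2 ⟨hb, hba⟩⟩
  refine (Finset.card_le_card h).trans ?_
  rw [mul_comm]
  exact Finset.card_biUnion_le_card_mul _ _ _ fun a ha => hd a (hT ha)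

/-- Every interface face lies in a simplex that joins the ball at the next radius, and each new
simplex accounts for at most `d` faces. -/
theorem card_interface_growBall {S B : Finset (Finset V)} {d : ℕ} {a₀ : Finset V} (h : a₀ ∈ S)
    (hd : ∀ a ∈ S, (B.filter (· ⊆ a)).card ≤ d) (r : ℕ) :
    (interface S B (growBall S B a₀ r)).card + d * (growBall S B a₀ r).card ≤
      d * (growBall S B a₀ (r + 1)).card := by
  set T := growBall S B a₀ r with hT
  set T' := growBall S B a₀ (r + 1) with hT'
  have hTT' : T ⊆ T' := Finset.subset_union_left
  have hsub : interface S B T ⊆ B.filter fun b => ∃ a ∈ T' \ T, b ⊆ a := by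
    intro b hb
    obtain ⟨hbB, ⟨a', ha', hba'⟩, a, ha, hba⟩ := Finset.mem_filter.1 hb
    obtain ⟨haS, haT⟩ := Finset.mem_sdiff.1 ha
    exact Finset.mem_filter.2 ⟨hbB, a, Finset.mem_sdiff.2 ⟨Finset.mem_union_right _
      (Finset.mem_filter.2 ⟨haS, a', ha', b, hbB, hba, hba'⟩), haT⟩, hba⟩
  have h1 := (Finset.card_le_card hsub).trans (card_filter_exists_subset_le
    (Finset.sdiff_subset.trans (growBall_subset h (r + 1))) hd)
  rw [Finset.card_sdiff_of_subset hTT', Nat.mul_sub] at h1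
  have h2 : d * T.card ≤ d * T'.card := Nat.mul_le_mul_left d (Finset.card_le_card hTT')
  omega

/-- The slow step bounds `q` times the interface, the trivial count bounds it once more; together
they give the factor `q + 1`, which also covers `q = 0`. -/
theorem exists_radius {S B : Finset (Finset V)} {d L : ℕ} (q : ℕ) {a₀ : Finset V} (h : a₀ ∈ S)
    (hd : ∀ a ∈ S, (B.filter (· ⊆ a)).card ≤ d) (hL : S.card < 2 ^ L) :
    ∃ r ≤ L * q, (q + 1) * (interface S B (growBall S B a₀ r)).card ≤
      2 * d * (growBall S B a₀ r).card := by
  have h1 : ∀ r, (interface S B (growBall S B a₀ r)).card ≤ d * (growBall S B a₀ r).card := by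
    intro r
    refine le_trans (Finset.card_le_card ?_) (card_filter_exists_subset_le (B := B)
      (growBall_subset h r) hd)
    exact fun b hb => Finset.mem_filter.2
      ⟨(Finset.mem_filter.1 hb).1, (Finset.mem_filter.1 hb).2.1⟩
  obtain ⟨r, hr, hq⟩ : ∃ r ≤ L * q, q * (interface S B (growBall S B a₀ r)).card ≤
      d * (growBall S B a₀ r).card := by
    rcases Nat.eq_zero_or_pos q with rfl | hq
    · exact ⟨0, Nat.zero_le _, by simp⟩
    · exact exists_slow_step hq _ _ (by simp [growBall])
        ((Finset.card_le_card (growBall_subset h _)).trans_lt hL)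
        (fun _ _ hab => Finset.card_le_card (growBall_mono S B a₀ hab))
        (card_interface_growBall h hd)
  refine ⟨r, hr, ?_⟩
  have := h1 r
  rw [add_mul, one_mul, mul_assoc, two_mul]
  exact add_le_add hq this

/-- One edge is spent in each simplex of a chain of adjacent simplices, passing through vertices of
the shared faces. -/
theorem exists_joined_of_mem_growBall {M : PreAbstractSimplicialComplex V}
    {f : Cochain 1 (realization M)} (hf : f ∈ cocycles 1 (realization M))
    {S B : Finset (Finset V)} (hS : ∀ a ∈ S, a ∈ M.faces) (hB : ∀ b ∈ B, b.Nonempty)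
    {a₀ : Finset V} (h : a₀ ∈ S) {u : V} (hu : u ∈ a₀) (r : ℕ) :
    ∀ a ∈ growBall S B a₀ r, ∀ v ∈ a, ∃ x, Joined f (r + 1) u v x := by
  induction r with
  | zero =>
    intro a ha v hv
    obtain rfl := Finset.mem_singleton.1 ha
    exact ⟨_, (joined_edge hf (hS _ h) hu hv).mono (by omega)⟩
  | succ r ih =>
    intro a ha v hv
    rcases Finset.mem_union.1 ha with ha | ha
    · obtain ⟨x, hx⟩ := ih a ha v hv
      exact ⟨x, hx.mono (by omega)⟩
    · obtain ⟨haS, a', ha', b, hb, hba, hba'⟩ := Finset.mem_filter.1 ha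
      obtain ⟨w, hw⟩ := hB b hb
      obtain ⟨x, hx⟩ := ih a' ha' w (hba' hw)
      exact ⟨_, hx.trans (joined_edge hf (hS a haS) (hba hw) hv)⟩

/-- If the cocycle vanishes on short loops, then removing few members of `B` from the dual graph
of `S` makes it trivial. -/
theorem exists_carving {M : PreAbstractSimplicialComplex V} {f : Cochain 1 (realization M)}
    (hf : f ∈ cocycles 1 (realization M)) {B : Finset (Finset V)} (hB : ∀ b ∈ B, b.Nonempty)
    {d q L p : ℕ} (hloop : ∀ u x, Joined f (2 * (L * q) + 3) u u x → x = 0) (N : ℕ) :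
    ∀ S : Finset (Finset V), S.card = N → N < 2 ^ L → (∀ a ∈ S, a ∈ M.faces) →
      (∀ a ∈ S, a.card = p) → (∀ a ∈ S, (B.filter (· ⊆ a)).card ≤ d) →
      ∃ (E : Finset (Finset V)) (ψ : Finset V → V → ZMod 2), E ⊆ B ∧
        (q + 1) * E.card ≤ 2 * d * N ∧
        (∀ a ∈ S, ∀ v ∈ a, ∀ w ∈ a,
          ψ a v + ψ a w = segValue f (stdSimplex.vertex v) (stdSimplex.vertex w)) ∧
        ∀ a ∈ S, ∀ b ∈ B, b ∉ E → b ⊆ a → ∀ v ∈ b, ψ b v = ψ a v := by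
  classical
  induction N using Nat.strong_induction_on with
  | _ N ih =>
    intro S hSN hNL hS hp hd
    rcases S.eq_empty_or_nonempty with rfl | ⟨a₀, ha₀⟩
    · exact ⟨∅, 0, Finset.empty_subset _, by simp, by simp, by simp⟩
    obtain ⟨u, hu⟩ := (M.isRelLowerSet_faces (hS a₀ ha₀)).1
    obtain ⟨r, hr, hcard⟩ := exists_radius q ha₀ hd (hSN ▸ hNL)
    have hjoin := exists_joined_of_mem_growBall hf hS hB ha₀ hu r
    have hT := growBall_subset (B := B) ha₀ r
    have hT0 : a₀ ∈ growBall S B a₀ r :=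
      growBall_mono S B a₀ (Nat.zero_le r) (Finset.mem_singleton_self a₀)
    set T := growBall S B a₀ r
    have hTpos : 0 < T.card := Finset.card_pos.2 ⟨a₀, hT0⟩
    have hTN : T.card ≤ N := hSN ▸ Finset.card_le_card hT
    have hST : (S \ T).card = N - T.card := by rw [Finset.card_sdiff_of_subset hT, hSN]
    obtain ⟨E, ψ, hEB, hE, hψ1, hψ2⟩ := ih (N - T.card) (by omega) (S \ T) hST (by omega)
      (fun a ha => hS a (Finset.sdiff_subset ha)) (fun a ha => hp a (Finset.sdiff_subset ha))
      (fun a ha => hd a (Finset.sdiff_subset ha))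
    -- The potential at `v` is the value of `f` on some short chain from `u` to `v`; two such chains
    -- and an edge close up to length `2 * (r + 1) + 1 ≤ 2 * (L * q) + 3`, where `hloop` applies.
    let ψ₀ : V → ZMod 2 := fun v => if h : ∃ x, Joined f (r + 1) u v x then h.choose else 0
    have hψ₀ : ∀ a ∈ T, ∀ v ∈ a, Joined f (r + 1) u v (ψ₀ v) := by
      intro a ha v hv
      have h := hjoin a ha v hv
      simp only [ψ₀]
      rw [dif_pos h]
      exact h.choose_spec
    have hself : ∀ a ∈ T, ∃ a' ∈ T, a ⊆ a' := fun a ha => ⟨a, ha, subset_rfl⟩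
    -- Equal cardinalities prevent a simplex outside `T` from lying inside one of `T`, so the choice
    -- between `ψ₀` and `ψ` is the right one for it.
    have hother : ∀ a ∈ S, a ∉ T → ¬ ∃ a' ∈ T, a ⊆ a' := by
      rintro a ha haT ⟨a', ha', h⟩
      rw [Finset.eq_of_subset_of_card_le h (by rw [hp a ha, hp a' (hT ha')])] at haT
      exact haT ha'
    refine ⟨interface S B T ∪ E, fun s => if ∃ a ∈ T, s ⊆ a then ψ₀ else ψ s,
      Finset.union_subset (Finset.filter_subset _ _) hEB, ?_, ?_, ?_⟩
    · refine (Nat.mul_le_mul_left _ (Finset.card_union_le _ _)).trans ?_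
      rw [mul_add]
      refine (add_le_add hcard hE).trans ?_
      rw [← mul_add, Nat.add_sub_cancel' hTN]
    · intro a ha v hv w hw
      by_cases haT : a ∈ T
      · simp only [if_pos (hself a haT)]
        have h := hloop u _ (Joined.mono (((hψ₀ a haT v hv).trans
          (joined_edge hf (hS a ha) hv hw)).trans (hψ₀ a haT w hw).symm) (by omega))
        have key : ∀ a b c : ZMod 2, a + b + c = 0 → a + c = b := by decide
        exact key _ _ _ h
      · simp only [if_neg (hother a ha haT)]
        exact hψ1 a (Finset.mem_sdiff.2 ⟨ha, haT⟩) v hv w hw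
    · intro a ha b hb hbE hba v hv
      rw [Finset.mem_union, not_or] at hbE
      by_cases haT : a ∈ T
      · simp only [if_pos (hself a haT)]
        rw [if_pos ⟨a, haT, hba⟩]
      · have hbT : ¬ ∃ a' ∈ T, b ⊆ a' := fun h => hbE.1
          (Finset.mem_filter.2 ⟨hb, h, a, Finset.mem_sdiff.2 ⟨ha, haT⟩, hba⟩)
        simp only [if_neg (hother a ha haT), if_neg hbT]
        exact hψ2 a (Finset.mem_sdiff.2 ⟨ha, haT⟩) b hb hbE.2 hba v hv

/-! ### From carvings to subcomplexes -/

theorem exists_local_potential {M : PreAbstractSimplicialComplex V}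
    {f : Cochain 1 (realization M)} (hf : f ∈ cocycles 1 (realization M)) :
    ∃ ψ : Finset V → V → ZMod 2, ∀ s ∈ M.faces, ∀ v ∈ s, ∀ w ∈ s,
      ψ s v + ψ s w = segValue f (stdSimplex.vertex v) (stdSimplex.vertex w) := by
  have h : ∀ s : Finset V, ∃ ψ : V → ZMod 2, s ∈ M.faces → ∀ v ∈ s, ∀ w ∈ s,
      ψ v + ψ w = segValue f (stdSimplex.vertex v) (stdSimplex.vertex w) := by
    intro s
    by_cases hs : s ∈ M.faces
    · obtain ⟨u, hu⟩ := (M.isRelLowerSet_faces hs).1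
      refine ⟨fun v => segValue f (stdSimplex.vertex u) (stdSimplex.vertex v),
        fun _ v hv w hw => ?_⟩
      show segValue f (stdSimplex.vertex u) (stdSimplex.vertex v) + _ = _
      rw [segValue_comm hf hs (vertex_support hu) (vertex_support hv)]
      exact segValue_triangle hf hs (vertex_support hv) (vertex_support hu) (vertex_support hw)
    · exact ⟨0, fun h => absurd h hs⟩
  choose ψ hψ using h
  exact ⟨ψ, hψ⟩

/-- A version of `exists_carving` in terms of a lower bound `σ` for the length of the loops on
which the cocycle does not vanish. -/
theorem exists_carving_of_le {M : PreAbstractSimplicialComplex V} {f : Cochain 1 (realization M)}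
    (hf : f ∈ cocycles 1 (realization M)) {B : Finset (Finset V)} (hB : ∀ b ∈ B, b.Nonempty)
    {d σ L p : ℕ} (hloop : ∀ l u x, Joined f l u u x → x ≠ 0 → σ ≤ l) (hL : 0 < L)
    (S : Finset (Finset V)) (hSL : S.card < 2 ^ L) (hS : ∀ a ∈ S, a ∈ M.faces)
    (hp : ∀ a ∈ S, a.card = p) (hd : ∀ a ∈ S, (B.filter (· ⊆ a)).card ≤ d) :
    ∃ (E : Finset (Finset V)) (ψ : Finset V → V → ZMod 2), E ⊆ B ∧
      E.card ≤ 2 * d * S.card ∧ σ * E.card ≤ 10 * L * d * S.card ∧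
      (∀ a ∈ S, ∀ v ∈ a, ∀ w ∈ a,
        ψ a v + ψ a w = segValue f (stdSimplex.vertex v) (stdSimplex.vertex w)) ∧
      ∀ a ∈ S, ∀ b ∈ B, b ∉ E → b ⊆ a → ∀ v ∈ b, ψ b v = ψ a v := by
  -- For `σ ≤ 3` no ball is worth growing: all the codimension-one faces are removed, at a cost
  -- within the bound.
  rcases lt_or_ge σ 4 with hσ | hσ
  · obtain ⟨ψ, hψ⟩ := exists_local_potential hf
    have hc := card_filter_exists_subset_le (B := B) (subset_refl S) hd
    refine ⟨B.filter fun b => ∃ a ∈ S, b ⊆ a, ψ, Finset.filter_subset _ _, ?_, ?_,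
      fun a ha => hψ a (hS a ha), fun a ha b hb hbE hba => ?_⟩
    · exact hc.trans (by nlinarith [Nat.zero_le (d * S.card)])
    · calc σ * _ ≤ 3 * (d * S.card) := Nat.mul_le_mul (by omega) hc
        _ ≤ 10 * L * (d * S.card) := Nat.mul_le_mul_right _ (by omega)
        _ = _ := by ring
    · exact absurd (Finset.mem_filter.2 ⟨hb, a, ha, hba⟩) hbE
  · have hdm := Nat.div_add_mod (σ - 4) (2 * L)
    have hml := Nat.mod_lt (σ - 4) (show 0 < 2 * L by omega)
    set q := (σ - 4) / (2 * L)
    -- This `q` makes `2 * (L * q) + 3 < σ`, so the loops met in the carving are too short to be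
    -- detected.
    have hq : 2 * (L * q) = 2 * L * q := by ring
    obtain ⟨E, ψ, hEB, hE, h1, h2⟩ := exists_carving hf hB (d := d) (q := q) (L := L) (p := p)
      (fun u x hx => by
        by_contra h0
        have := hloop _ u x hx h0
        omega) S.card S rfl hSL hS hp hd
    refine ⟨E, ψ, hEB, ?_, ?_, h1, h2⟩
    · exact (Nat.le_mul_of_pos_left _ (Nat.succ_pos q)).trans hE
    · have hσq : σ ≤ 5 * L * (q + 1) := by
        have e : 5 * L * (q + 1) = 5 * (L * q) + 5 * L := by ring
        omega
      calc σ * E.card ≤ 5 * L * (q + 1) * E.card := Nat.mul_le_mul_right _ hσq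
        _ = 5 * L * ((q + 1) * E.card) := by ring
        _ ≤ 5 * L * (2 * d * S.card) := Nat.mul_le_mul_left _ hE
        _ = _ := by ring

/-- Passing from a complex `Z` to a subcomplex of dimension one less that cuts the class of `f`
on `Z`. -/
theorem exists_cut_subcomplex {M : PreAbstractSimplicialComplex V} (f : cocycles 1 (realization M))
    {Z : PreAbstractSimplicialComplex V} (hZ : Z ≤ M) {n i L : ℕ} (hL : 0 < L)
    (hdim : ∀ s ∈ Z.faces, s.card + i ≤ n + 1)
    (hZL : {s | s ∈ Z.faces ∧ s.card + i = n + 1}.ncard < 2 ^ L) :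
    ∃ Z' : PreAbstractSimplicialComplex V, Z' ≤ Z ∧ (∀ s ∈ Z'.faces, s.card + (i + 1) ≤ n + 1) ∧
      {s | s ∈ Z'.faces ∧ s.card + (i + 1) = n + 1}.ncard ≤
        2 * (n + 1) * {s | s ∈ Z.faces ∧ s.card + i = n + 1}.ncard ∧
      sys M (classOf f) * ({s | s ∈ Z'.faces ∧ s.card + (i + 1) = n + 1}.ncard : ℕ∞) ≤
        ((10 * L * (n + 1) * {s | s ∈ Z.faces ∧ s.card + i = n + 1}.ncard : ℕ) : ℕ∞) ∧
      HasPotential f.1 (Z.faces \ Z'.faces) := by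
  classical
  have hZM : ∀ s ∈ Z.faces, s ∈ M.faces := fun s hs => hZ hs
  set S : Finset (Finset V) := Finset.univ.filter fun s => s ∈ Z.faces ∧ s.card + i = n + 1
  set B : Finset (Finset V) := Finset.univ.filter fun s => s ∈ Z.faces ∧ s.card + (i + 1) = n + 1
  have hSc : {s | s ∈ Z.faces ∧ s.card + i = n + 1}.ncard = S.card := by
    rw [← Set.ncard_coe_finset]
    congr 1
    ext s
    simp [S]
  rw [hSc] at hZL ⊢
  have memS : ∀ s, s ∈ S ↔ s ∈ Z.faces ∧ s.card + i = n + 1 := fun s => by simp [S]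
  have memB : ∀ s, s ∈ B ↔ s ∈ Z.faces ∧ s.card + (i + 1) = n + 1 := fun s => by simp [B]
  have hd : ∀ a ∈ S, (B.filter (· ⊆ a)).card ≤ n + 1 := by
    intro a ha
    have hac := ((memS a).1 ha).2
    have hsub : B.filter (· ⊆ a) ⊆ a.image fun v => a.erase v := by
      intro b hb
      obtain ⟨hbB, hba⟩ := Finset.mem_filter.1 hb
      have hbc := ((memB b).1 hbB).2
      obtain ⟨v, hv⟩ : ∃ v, a \ b = {v} := by
        rw [← Finset.card_eq_one, Finset.card_sdiff_of_subset hba]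
        omega
      refine Finset.mem_image.2 ⟨v, (Finset.mem_sdiff.1 (hv ▸ Finset.mem_singleton_self v)).1, ?_⟩
      rw [Finset.erase_eq, ← hv, Finset.sdiff_sdiff_eq_self hba]
    exact ((Finset.card_le_card hsub).trans Finset.card_image_le).trans (by omega)
  let K := 10 * L * (n + 1) * S.card
  -- For an infinite systole, the value `K + 1` exceeds the bound on `σ * E.card` and so forces `E`
  -- to be empty; the product with `⊤` is then zero.
  let σ : ℕ := if sys M (classOf f) = ⊤ then K + 1 else (sys M (classOf f)).toNat
  have hσ : (σ : ℕ∞) ≤ sys M (classOf f) := by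
    simp only [σ]
    split_ifs with h
    · rw [h]
      exact le_top
    · exact (ENat.natCast_toNat h).le
  obtain ⟨E, ψ, hEB, hE1, hE2, hψ1, hψ2⟩ := exists_carving_of_le f.2 (B := B)
    (fun b hb => (Z.isRelLowerSet_faces ((memB b).1 hb).1).1) (d := n + 1) (σ := σ) (L := L)
    (p := n + 1 - i)
    (fun l u x h hx => by exact_mod_cast hσ.trans (h.sys_le f hx)) hL S hZL
    (fun a ha => hZM a ((memS a).1 ha).1)
    (fun a ha => by
      have := ((memS a).1 ha).2
      omega) hd
  have hEZ : ∀ s ∈ E, s ∈ Z.faces ∧ s.card + (i + 1) = n + 1 := fun s hs => (memB s).1 (hEB hs)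
  let Z' : PreAbstractSimplicialComplex V :=
    { faces := {s | s ∈ Z.faces ∧ (s.card + (i + 2) ≤ n + 1 ∨ s ∈ E)}
      isRelLowerSet_faces := by
        rintro s ⟨hs, hs'⟩
        refine ⟨(Z.isRelLowerSet_faces hs).1, fun t hts ht =>
          ⟨(Z.isRelLowerSet_faces hs).2 hts ht, ?_⟩⟩
        rcases hs' with h | h
        · have := Finset.card_le_card hts
          left
          omega
        · rcases hts.eq_or_ssubset with rfl | hlt
          · exact Or.inr h
          · have h1 := Finset.card_lt_card hlt
            have h2 := (hEZ s h).2
            left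
            omega }
  have hE' : {s | s ∈ Z'.faces ∧ s.card + (i + 1) = n + 1}.ncard = E.card := by
    rw [← Set.ncard_coe_finset]
    congr 1
    ext s
    constructor
    · rintro ⟨⟨_, h | h⟩, h'⟩
      · omega
      · exact h
    · intro h
      exact ⟨⟨(hEZ s h).1, Or.inr h⟩, (hEZ s h).2⟩
  obtain ⟨ψ', hψ'⟩ := exists_local_potential f.2
  refine ⟨Z', fun s hs => hs.1, ?_, hE'.le.trans hE1, ?_, ?_⟩
  · rintro s ⟨_, h | h⟩
    · omega
    · exact (hEZ s h).2.le
  · rw [hE']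
    by_cases h : sys M (classOf f) = ⊤
    · have hσK : σ = K + 1 := if_pos h
      have hE0 : E.card = 0 := by
        by_contra h0
        have h1 : σ * 1 ≤ σ * E.card := Nat.mul_le_mul_left σ (Nat.pos_of_ne_zero h0)
        have h2 : σ * E.card ≤ K := hE2
        omega
      rw [hE0]
      simp
    · have hσs : ((sys M (classOf f)).toNat : ℕ∞) = sys M (classOf f) := ENat.natCast_toNat h
      have hσK : σ = (sys M (classOf f)).toNat := if_neg h
      rw [hσK] at hE2
      rw [← hσs]
      exact_mod_cast hE2
  · have hcases : ∀ s ∈ Z.faces \ Z'.faces, s ∈ S ∨ s ∈ B ∧ s ∉ E := by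
      rintro s ⟨hs, hs'⟩
      have h1 := hdim s hs
      have h2 : ¬ (s.card + (i + 2) ≤ n + 1) := fun h => hs' ⟨hs, Or.inl h⟩
      have h3 : s ∉ E := fun h => hs' ⟨hs, Or.inr h⟩
      by_cases h : s.card + i = n + 1
      · exact Or.inl ((memS s).2 ⟨hs, h⟩)
      · exact Or.inr ⟨(memB s).2 ⟨hs, by omega⟩, h3⟩
    -- Among discarded faces, proper inclusions only go from a codimension-one face into a top one,
    -- where `hψ2` gives compatibility. Faces in no top simplex are unconstrained and take a local
    -- potential.
    refine ⟨fun s => if ∃ a ∈ S, s ⊆ a then ψ s else ψ' s, fun s hs v hv w hw => ?_,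
      fun s hs t ht hst v hv => ?_⟩
    · by_cases h : ∃ a ∈ S, s ⊆ a
      · simp only [if_pos h]
        rcases hcases s hs with hsS | ⟨hsB, hsE⟩
        · exact hψ1 s hsS v hv w hw
        · obtain ⟨a, ha, hsa⟩ := h
          rw [hψ2 a ha s hsB hsE hsa v hv, hψ2 a ha s hsB hsE hsa w hw]
          exact hψ1 a ha v (hsa hv) w (hsa hw)
      · simp only [if_neg h]
        exact hψ' s (hZM s hs.1) v hv w hw
    · rcases hst.eq_or_ssubset with rfl | hlt
      · rfl
      · have hc := Finset.card_lt_card hlt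
        rcases hcases t ht with htS | ⟨htB, _⟩
        · rcases hcases s hs with hsS | ⟨hsB, hsE⟩
          · have h1 := ((memS t).1 htS).2
            have h2 := ((memS s).1 hsS).2
            omega
          · simp only [if_pos (⟨t, htS, hst⟩ : ∃ a ∈ S, s ⊆ a),
              if_pos (⟨t, htS, subset_rfl⟩ : ∃ a ∈ S, t ⊆ a)]
            exact hψ2 t htS s hsB hsE hst v hv
        · have h1 := ((memB t).1 htB).2
          rcases hcases s hs with hsS | ⟨hsB, _⟩
          · have h2 := ((memS s).1 hsS).2
            omega
          · have h2 := ((memB s).1 hsB).2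
            omega

end SimplicialSystole

/-! ### Iterated cuts and the final estimate -/

namespace SimplicialSystole

open SingularMod2

section

theorem vol_eq_ncard {V : Type*} (n : ℕ) (M : PreAbstractSimplicialComplex V) :
    vol n M = {s | s ∈ M.faces ∧ s.card + 0 = n + 1}.ncard := rfl

variable {V : Type*} [Fintype V] [LinearOrder V]

/-- Iterated cuts along the classes of `f 0, …, f (j - 1)`. -/
theorem exists_iterated_cut {M : PreAbstractSimplicialComplex V} {n L : ℕ} (hM : DimLE M n)
    (f : ℕ → cocycles 1 (realization M)) (hL : 0 < L)
    (hML : (2 * (n + 1)) ^ (n + 1) * vol n M < 2 ^ L) (j : ℕ) (hj : j ≤ n + 1) :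
    ∃ Z : PreAbstractSimplicialComplex V, Z ≤ M ∧ (∀ s ∈ Z.faces, s.card + j ≤ n + 1) ∧
      {s | s ∈ Z.faces ∧ s.card + j = n + 1}.ncard ≤ (2 * (n + 1)) ^ j * vol n M ∧
      (∏ i ∈ Finset.range j, sys M (classOf (f i))) *
          ({s | s ∈ Z.faces ∧ s.card + j = n + 1}.ncard : ℕ∞) ≤
        (((10 * L * (n + 1)) ^ j * vol n M : ℕ) : ℕ∞) ∧
      ∃ P : ℕ → Set (Finset V), (∀ i < j, P i ⊆ M.faces ∧ HasPotential (f i).1 (P i)) ∧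
        ∀ s ∈ M.faces, s ∉ Z.faces → ∃ i < j, s ∈ P i := by
  induction j with
  | zero =>
    refine ⟨M, le_rfl, hM, by rw [pow_zero, one_mul, vol_eq_ncard], ?_, fun _ => ∅,
      fun i hi => absurd hi (Nat.not_lt_zero i), fun s hs hs' => absurd hs hs'⟩
    rw [Finset.prod_range_zero, pow_zero, one_mul, one_mul, vol_eq_ncard]
  | succ j ih =>
    obtain ⟨Z, hZM, hdim, hN, hprod, P, hP, hcov⟩ := ih (by omega)
    -- The number of top faces grows by at most `2 * (n + 1)` per step, so one `L` serves all steps.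
    have hZL : {s | s ∈ Z.faces ∧ s.card + j = n + 1}.ncard < 2 ^ L :=
      (hN.trans (Nat.mul_le_mul_right _ (Nat.pow_le_pow_right (by omega) (by omega)))).trans_lt hML
    obtain ⟨Z', hZ', hdim', hN', hsys, hpot⟩ := exists_cut_subcomplex (f j) hZM hL hdim hZL
    refine ⟨Z', hZ'.trans hZM, hdim', ?_, ?_,
      fun i => if i = j then Z.faces \ Z'.faces else P i, fun i hi => ?_, fun s hs hs' => ?_⟩
    · refine hN'.trans ((Nat.mul_le_mul_left _ hN).trans (le_of_eq ?_))
      ring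
    · rw [Finset.prod_range_succ, mul_assoc]
      refine (mul_le_mul_right hsys _).trans ?_
      calc _ = ((10 * L * (n + 1) : ℕ) : ℕ∞) *
            ((∏ i ∈ Finset.range j, sys M (classOf (f i))) *
              ({s | s ∈ Z.faces ∧ s.card + j = n + 1}.ncard : ℕ∞)) := by
            push_cast
            ring
        _ ≤ ((10 * L * (n + 1) : ℕ) : ℕ∞) * (((10 * L * (n + 1)) ^ j * vol n M : ℕ) : ℕ∞) :=
            mul_le_mul_right hprod _
        _ = _ := by
            push_cast
            ring
    · rcases eq_or_ne i j with rfl | hij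
      · simp only [if_pos]
        exact ⟨fun s hs => hZM hs.1, hpot⟩
      · simp only [if_neg hij]
        exact hP i (by omega)
    · by_cases hsZ : s ∈ Z.faces
      · refine ⟨j, Nat.lt_succ_self j, ?_⟩
        simp only [if_pos]
        exact ⟨hsZ, hs'⟩
      · obtain ⟨i, hi, hsi⟩ := hcov s hs hsZ
        refine ⟨i, by omega, ?_⟩
        simp only [if_neg hi.ne]
        exact hsi

/-- The systolic inequality with an explicit logarithmic factor. -/
theorem prod_sys_mul_cut_le {M : PreAbstractSimplicialComplex V} {n L : ℕ} (hM : DimLE M n)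
    (hL : 0 < L) (hML : (2 * (n + 1)) ^ (n + 1) * vol n M < 2 ^ L) {k : ℕ} (hk : k ≤ n + 1)
    (α : Fin k → Cohomology 1 (realization M)) :
    (∏ i, sys M (α i)) * cut n M (Cohomology.cupProd k α) ≤
      (((10 * L * (n + 1)) ^ k * vol n M : ℕ) : ℕ∞) := by
  choose g hg using fun i => Submodule.Quotient.mk_surjective _ (α i)
  obtain rfl : (fun i => classOf (g i)) = α := funext hg
  let f : ℕ → cocycles 1 (realization M) := fun i => if h : i < k then g ⟨i, h⟩ else 0
  have hf : ∀ i : Fin k, f i = g i := fun i => dif_pos i.2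
  obtain ⟨Z, hZM, hdim, -, hprod, P, hP, hcov⟩ := exists_iterated_cut hM f hL hML k hk
  have hcuts : Cuts M Z (Cohomology.cupProd k fun i => classOf (g i)) := by
    refine cuts_cupProd g (fun i => P i) (fun i => (hP i i.2).1) (fun i => ?_) fun s hs hs' => ?_
    · rw [← hf]
      exact (hP i i.2).2
    · obtain ⟨i, hi, hsi⟩ := hcov s hs hs'
      exact ⟨⟨i, hi⟩, hsi⟩
  have hcut : cut n M (Cohomology.cupProd k fun i => classOf (g i)) ≤
      ({s | s ∈ Z.faces ∧ s.card + k = n + 1}.ncard : ℕ∞) := by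
    rw [(Set.toFinite _).cast_ncard_eq]
    exact iInf_le_of_le Z (iInf_le_of_le hZM (iInf_le_of_le hdim (iInf_le _ hcuts)))
  refine (mul_le_mul_right hcut _).trans (le_trans (le_of_eq ?_) hprod)
  rw [Finset.prod_range]
  simp only [hf]

/-- After `n + 1` cuts no face is left, so the empty subcomplex cuts the product; the remaining
classes receive empty families. -/
theorem cut_cupProd_eq_zero {M : PreAbstractSimplicialComplex V} {n : ℕ} (hM : DimLE M n)
    {k : ℕ} (hk : n + 1 < k) (α : Fin k → Cohomology 1 (realization M)) :
    cut n M (Cohomology.cupProd k α) = 0 := by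
  choose g hg using fun i => Submodule.Quotient.mk_surjective _ (α i)
  obtain rfl : (fun i => classOf (g i)) = α := funext hg
  let f : ℕ → cocycles 1 (realization M) := fun i => if h : i < k then g ⟨i, h⟩ else 0
  have hf : ∀ i : Fin k, f i = g i := fun i => dif_pos i.2
  obtain ⟨Z, hZM, hdim, -, -, P, hP, hcov⟩ := exists_iterated_cut (n := n) hM f
    (Nat.succ_pos ((2 * (n + 1)) ^ (n + 1) * vol n M))
    (Nat.lt_two_pow_self.trans (Nat.pow_lt_pow_right one_lt_two (Nat.lt_succ_self _))) (n + 1)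
    le_rfl
  have hZ : ∀ s, s ∉ Z.faces := fun s hs => by
    have h1 := hdim s hs
    have h2 := Finset.card_pos.2 (Z.isRelLowerSet_faces hs).1
    omega
  have hcuts : Cuts M Z (Cohomology.cupProd k fun i => classOf (g i)) := by
    refine cuts_cupProd g (fun i => {s | i.1 < n + 1 ∧ s ∈ P i}) (fun i s hs => ?_)
      (fun i => ?_) fun s hs hs' => ?_
    · exact (hP i hs.1).1 hs.2
    · rw [← hf]
      by_cases hi : i.1 < n + 1
      · have e : {s | i.1 < n + 1 ∧ s ∈ P i} = P i := Set.ext fun s => and_iff_right hi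
        rw [e]
        exact (hP i hi).2
      · exact ⟨0, fun s hs => absurd hs.1 hi, fun s hs => absurd hs.1 hi⟩
    · obtain ⟨i, hi, hsi⟩ := hcov s hs hs'
      exact ⟨⟨i, hi.trans hk⟩, hi, hsi⟩
  refine le_antisymm ?_ zero_le
  refine (iInf_le_of_le Z (iInf_le_of_le hZM (iInf_le_of_le
    (fun s hs => absurd hs (hZ s)) (iInf_le _ hcuts)))).trans (le_of_eq ?_)
  rw [Set.encard_eq_zero]
  exact Set.eq_empty_of_forall_notMem fun s hs => hZ s hs.1

end

/-- Powers of the logarithm are dominated by any positive power. -/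
theorem exists_log_bound (n : ℕ) {ε : ℝ} (hε : 0 < ε) :
    ∃ C : ℝ≥0, ∀ N : ℕ, ∃ L : ℕ, 0 < L ∧ (2 * (n + 1)) ^ (n + 1) * N < 2 ^ L ∧
      ∀ k ≤ n + 1, (((10 * L * (n + 1)) ^ k * N : ℕ) : ℝ≥0) ≤ C * (N : ℝ≥0) ^ (1 + ε) := by
  set c := 2 * (n + 1) * (n + 1) with hc
  -- At most `n + 1` factors `L` occur, each at most `A * N ^ δ`, so together they cost `N ^ ε`. The
  -- summand `c` in `L` pays for `(2 * (n + 1)) ^ (n + 1) ≤ 2 ^ c`.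
  set δ : ℝ := ε / (n + 1) with hδ
  have hδ0 : 0 < δ := by positivity
  have hlog2 : 0 < Real.log 2 := Real.log_pos one_lt_two
  set A : ℝ := 1 / (δ * Real.log 2) + (1 + c) with hA
  have hA0 : 0 < A := by positivity
  refine ⟨Real.toNNReal ((10 * A * (n + 1)) ^ (n + 1)), fun N => ⟨Nat.log 2 N + (1 + c),
    by omega, ?_, fun k hk => ?_⟩⟩
  · have h1 : (2 * (n + 1)) ^ (n + 1) ≤ 2 ^ c := by
      rw [hc, pow_mul]
      exact Nat.pow_le_pow_left Nat.lt_two_pow_self.le _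
    calc (2 * (n + 1)) ^ (n + 1) * N ≤ 2 ^ c * N := Nat.mul_le_mul_right _ h1
      _ < 2 ^ c * 2 ^ (Nat.log 2 N + 1) :=
        Nat.mul_lt_mul_of_pos_left (Nat.lt_pow_succ_log_self one_lt_two N) (by positivity)
      _ = 2 ^ (Nat.log 2 N + (1 + c)) := by ring
  · rcases Nat.eq_zero_or_pos N with rfl | hN
    · simp
    have hN1 : (1 : ℝ) ≤ N := by exact_mod_cast hN
    have hlog : (Nat.log 2 N : ℝ) ≤ 1 / (δ * Real.log 2) * (N : ℝ) ^ δ := by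
      have h1 : (Nat.log 2 N : ℝ) * Real.log 2 ≤ Real.log N := by
        rw [← Real.log_pow]
        refine Real.log_le_log (by positivity) ?_
        exact_mod_cast Nat.pow_log_le_self 2 hN.ne'
      have h2 := Real.log_le_rpow_div (x := N) (by positivity) hδ0
      calc (Nat.log 2 N : ℝ) ≤ Real.log N / Real.log 2 := (le_div_iff₀ hlog2).2 h1
        _ ≤ ((N : ℝ) ^ δ / δ) / Real.log 2 := div_le_div_of_nonneg_right h2 hlog2.le
        _ = _ := by field_simp
    have hpow1 : 1 ≤ (N : ℝ) ^ δ := Real.one_le_rpow hN1 hδ0.le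
    have hL : ((Nat.log 2 N + (1 + c) : ℕ) : ℝ) ≤ A * (N : ℝ) ^ δ := by
      push_cast
      rw [hA, add_mul]
      refine add_le_add hlog ?_
      exact le_mul_of_one_le_right (by positivity) hpow1
    have hbase : (10 * (Nat.log 2 N + (1 + c)) * (n + 1)) ^ k ≤
        (10 * (Nat.log 2 N + (1 + c)) * (n + 1)) ^ (n + 1) :=
      Nat.pow_le_pow_right (by positivity) hk
    rw [← NNReal.coe_le_coe]
    push_cast
    rw [Real.coe_toNNReal _ (by positivity)]
    calc (10 * ((Nat.log 2 N : ℝ) + (1 + (c : ℝ))) * ((n : ℝ) + 1)) ^ k * (N : ℝ)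
        ≤ (10 * ((Nat.log 2 N : ℝ) + (1 + (c : ℝ))) * ((n : ℝ) + 1)) ^ (n + 1) * (N : ℝ) := by
          refine mul_le_mul_of_nonneg_right ?_ (by positivity)
          exact_mod_cast hbase
      _ ≤ (10 * (A * (N : ℝ) ^ δ) * ((n : ℝ) + 1)) ^ (n + 1) * (N : ℝ) := by
          push_cast at hL
          gcongr
      _ = (10 * A * ((n : ℝ) + 1)) ^ (n + 1) * (((N : ℝ) ^ δ) ^ (n + 1) * N) := by
          rw [show 10 * (A * (N : ℝ) ^ δ) * ((n : ℝ) + 1) =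
            10 * A * ((n : ℝ) + 1) * (N : ℝ) ^ δ by ring, mul_pow, mul_assoc]
      _ = (10 * A * ((n : ℝ) + 1)) ^ (n + 1) * (N : ℝ) ^ (1 + ε) := by
          congr 1
          rw [← Real.rpow_natCast, ← Real.rpow_mul (by positivity), add_comm 1 ε,
            Real.rpow_add_one (by positivity)]
          congr 2
          rw [hδ]
          push_cast
          field_simp

end SimplicialSystole
end

open SingularMod2 SimplicialSystole in
theorem theorem4 (n : ℕ) (ε : ℝ) (hε : 0 < ε) :
    ∃ C : ℝ≥0, ∀ (V : Type*) [Fintype V] [LinearOrder V] (M : PreAbstractSimplicialComplex V),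
      DimLE M n → ∀ (k : ℕ) (α : Fin k → Cohomology 1 (realization M)),
        Cohomology.cupProd k α ≠ 0 →
          (∏ i, (sys M (α i) : ℝ≥0∞)) * (cut n M (Cohomology.cupProd k α) : ℝ≥0∞) ≤
            C * (vol n M : ℝ≥0∞) ^ (1 + ε) := by
  obtain ⟨C, hC⟩ := exists_log_bound n hε
  refine ⟨C, fun V _ _ M hM k α _ => ?_⟩
  rcases lt_or_ge (n + 1) k with hk | hk
  · rw [cut_cupProd_eq_zero hM hk]
    simp
  · obtain ⟨L, hL, hML, hbound⟩ := hC (vol n M)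
    have h := ENat.toENNReal_le.2 (prod_sys_mul_cut_le hM hL hML hk α)
    have hprod : ((∏ i, sys M (α i) : ℕ∞) : ℝ≥0∞) = ∏ i, (sys M (α i) : ℝ≥0∞) :=
      map_prod ENat.toENNRealRingHom _ _
    rw [ENat.toENNReal_mul, hprod, ENat.toENNReal_coe] at h
    refine h.trans ?_
    have hb := ENNReal.coe_le_coe.2 (hbound k hk)
    rwa [ENNReal.coe_natCast, ENNReal.coe_mul, ENNReal.coe_rpow_of_nonneg _ (by positivity),
      ENNReal.coe_natCast] at hb
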